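/- **Model.** There are $n\ge 1$ candidates. Candidate $i$ has a pair of values $\xi_i,\rho_i\ge 0$ (its utility for the sender and for the receiver), with all $\xi_i$ distinct and all $\rho_i$ distinct. The candidates arrive one per round in uniformly random order. The sender initially knows only $n$. In round $t$ she sees the value pair of the arriving candidate and sends a signal HIRE or NOT, according to a randomized mechanism $\phi$ to which she has committed and which maps the arrivals so far (and her own past randomization) to a distribution over signals. She ignores cardinal values: her signals depend on the values only through the two rankings of the candidates that have arrived. The receiver knows $\phi$ and all value pairs, hears the signals, decides in each round irrevocably whether to hire the current candidate, and is told the identity of each candidate she has rejected (disclosure). The receiver maximizes the probability of hiring her best candidate $c_R=\arg\max_i\rho_i$. The mechanism $\phi$ is persuasive on an instance if, in every round that an obedient receiver can reach and given all her information there (rejected candidates, signals, including the current one), being obedient from then on (hire upon HIRE, do not hire upon NOT) maximizes her conditional probability of hiring $c_R$ among all her strategies. The sender's success probability is the probability that an obedient receiver hires $c_S=\arg\max_i\xi_i$. *First-Opt* signals NOT in the first $\lfloor n/2\rfloor$ rounds, and afterwards signals HIRE for the first candidate that is the best one so far with respect to $\xi$ or with respect to $\rho$; if there was no HIRE signal before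 the last round, it signals HIRE in the last round. After a HIRE signal it sends only NOT. The utilities are *negatively correlated* if for each $k\in\{1,\dots,n\}$ the candidate of rank $k$ for the sender has rank $n-k+1$ for the receiver. **Theorem.** Let $n\ge 1$. First-Opt ignores cardinal values and is persuasive on every instance with $n$ candidates. On every instance with negatively correlated utilities it maximizes the sender's success probability among all mechanisms that ignore cardinal values and are persuasive on this instance (in particular, among all those that are persuasive on all instances). For $n\ge 2$ this maximum equals $$\frac{n}{4(n-1)}\ \text{ if } n \text{ is even},\qquad \frac{n+1}{4n}\ \text{ if } n \text{ is odd},$$ and thus tends to $\frac14$ as $n\to\infty$. -/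

import Mathlib

namespace SecretaryPersuasion

/-- `n` candidates, each with a pair of non-negative values: `xi i` is the utility of the sender and
`rho i` the utility of the receiver when candidate `i` is hired. No player values two candidates
equally. -/
structure Candidates (n : ℕ) where
  xi : Fin n → ℝ
  rho : Fin n → ℝ
  xi_nonneg : ∀ i, 0 ≤ xi i
  rho_nonneg : ∀ i, 0 ≤ rho i
  xi_injective : Function.Injective xi
  rho_injective : Function.Injective rho

/-- The rank of candidate `i` with respect to the values `v`; the best candidate has rank `1`. -/
noncomputable def rank {n : ℕ} (v : Fin n → ℝ) (i : Fin n) : ℕ :=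
  (Finset.univ.filter fun j => v i ≤ v j).card

/-- The candidate of rank `k` for the sender has rank `n - k + 1` for the receiver. -/
def Candidates.NegativelyCorrelated {n : ℕ} (I : Candidates n) : Prop :=
  ∀ i, rank I.xi i + rank I.rho i = n + 1

/-- The pairs (sender value, receiver value) revealed to the sender, round by round, when candidate
`π t` arrives in round `t`. Rounds are numbered from `0` to `n - 1`. -/
def Candidates.arrivals {n : ℕ} (I : Candidates n) (π : Equiv.Perm (Fin n)) :
    Fin n → ℝ × ℝ :=
  fun t => (I.xi (π t), I.rho (π t))

/-- A direct randomized signaling strategy of a sender who knows only `n` in advance. A sequence of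
signals is a function `σ : Fin n → Bool`, where `true` stands for HIRE and `false` for NOT.
`hire t θ σ` is the probability that the signal in round `t` is HIRE, given the pairs
`θ 0, …, θ t` of the candidates that have arrived and the signals `σ 0, …, σ (t - 1)` already sent.
Conditioning on the signals already sent allows for arbitrary dependence between the internal
randomizations of different rounds. -/
structure Mechanism (n : ℕ) where
  hire : Fin n → (Fin n → ℝ × ℝ) → (Fin n → Bool) → ℝ
  hire_nonneg : ∀ t θ σ, 0 ≤ hire t θ σ
  hire_le_one : ∀ t θ σ, hire t θ σ ≤ 1
  causal : ∀ t θ θ' σ σ', (∀ r ≤ t, θ r = θ' r) → (∀ r < t, σ r = σ' r) →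
    hire t θ σ = hire t θ' σ'

/-- The sender ignores cardinal values: her signals depend on the values of the candidates that
have arrived only through the two rankings of these candidates. -/
def Mechanism.IgnoresCardinalValues {n : ℕ} (φ : Mechanism n) : Prop :=
  ∀ t θ θ' σ,
    (∀ r ≤ t, ∀ s ≤ t, ((θ r).1 < (θ s).1 ↔ (θ' r).1 < (θ' s).1) ∧
      ((θ r).2 < (θ s).2 ↔ (θ' r).2 < (θ' s).2)) →
    φ.hire t θ σ = φ.hire t θ' σ

/-- The probability that the candidates arrive in the order `π` (all orders are equally likely) and
that the mechanism produces the signals `σ` as long as nobody is hired. -/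
noncomputable def Mechanism.prob {n : ℕ} (φ : Mechanism n) (I : Candidates n)
    (π : Equiv.Perm (Fin n)) (σ : Fin n → Bool) : ℝ :=
  (1 / (n.factorial : ℝ)) * ∏ t, if σ t = true then φ.hire t (I.arrivals π) σ
    else 1 - φ.hire t (I.arrivals π) σ

/-- A strategy of the receiver with disclosure: `hires t π σ` says that she hires in round `t` if
she has not hired before. Her decision is based on the candidates `π 0, …, π (t - 1)` rejected so
far and the signals `σ 0, …, σ t`; being indexed by the candidates, it may also depend on all
valuation pairs and on the mechanism. (A randomized strategy is a mixture of such strategies and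
cannot be better than all of them.) -/
structure ReceiverStrategy (n : ℕ) where
  hires : Fin n → Equiv.Perm (Fin n) → (Fin n → Bool) → Prop
  causal : ∀ t π π' σ σ', (∀ r < t, π r = π' r) → (∀ r ≤ t, σ r = σ' r) →
    (hires t π σ ↔ hires t π' σ')

/-- Always hire upon HIRE, never hire upon NOT. -/
def obedient (n : ℕ) : ReceiverStrategy n where
  hires t _ σ := σ t = true
  causal t _ _ _ _ _ hσ := by rw [hσ t le_rfl]

/-- If the receiver uses `τ` from round `t₀` on, having hired nobody before, then somebody is hired
and this is the best candidate with respect to the values `v`. -/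
def ReceiverStrategy.HiresBestFrom {n : ℕ} (τ : ReceiverStrategy n) (t₀ : ℕ) (v : Fin n → ℝ)
    (π : Equiv.Perm (Fin n)) (σ : Fin n → Bool) : Prop :=
  ∃ t : Fin n, t₀ ≤ t ∧ τ.hires t π σ ∧ (∀ r < t, t₀ ≤ r → ¬ τ.hires r π σ) ∧
    ∀ j, v j ≤ v (π t)

/-- The sender's success probability: the probability that her best candidate is hired when the
receiver is obedient. -/
noncomputable def Mechanism.senderSuccess {n : ℕ} (φ : Mechanism n) (I : Candidates n) : ℝ :=
  open Classical in
  ∑ π : Equiv.Perm (Fin n), ∑ σ : Fin n → Bool,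
    if (obedient n).HiresBestFrom 0 I.xi π σ then φ.prob I π σ else 0

/-- The probability that the receiver observes the rejected candidates `π₀ r`, `r < t₀`, and the
signals `σ₀ r`, `r ≤ t₀`, and that using `τ` from round `t₀` on she hires her best candidate. This is
the conditional success probability of `τ` given her information in round `t₀`, multiplied by the
probability of this information. -/
noncomputable def Mechanism.receiverSuccessAt {n : ℕ} (φ : Mechanism n) (I : Candidates n)
    (t₀ : Fin n) (π₀ : Equiv.Perm (Fin n)) (σ₀ : Fin n → Bool) (τ : ReceiverStrategy n) : ℝ :=
  open Classical in
  ∑ π : Equiv.Perm (Fin n), ∑ σ : Fin n → Bool,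
    if (∀ r < t₀, π r = π₀ r) ∧ (∀ r ≤ t₀, σ r = σ₀ r) ∧ τ.HiresBestFrom t₀ I.rho π σ
      then φ.prob I π σ else 0

/-- Persuasiveness with disclosure for ordinal receiver utility, when the receiver knows the
valuation pairs in `I`: in every round `t₀` that an obedient receiver can reach, whatever candidates
were rejected and whatever the current signal is, being obedient from now on maximizes the
receiver's success probability given her information. -/
def Mechanism.PersuasiveOn {n : ℕ} (φ : Mechanism n) (I : Candidates n) : Prop :=
  ∀ (t₀ : Fin n) (π₀ : Equiv.Perm (Fin n)) (σ₀ : Fin n → Bool), (∀ r < t₀, σ₀ r = false) →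
    ∀ τ : ReceiverStrategy n,
      φ.receiverSuccessAt I t₀ π₀ σ₀ τ ≤ φ.receiverSuccessAt I t₀ π₀ σ₀ (obedient n)

/-- Among the candidates that have arrived up to round `t`, the one of round `t` is best for the
sender or best for the receiver. -/
def BestSoFar {n : ℕ} (θ : Fin n → ℝ × ℝ) (t : Fin n) : Prop :=
  (∀ r ≤ t, (θ r).1 ≤ (θ t).1) ∨ (∀ r ≤ t, (θ r).2 ≤ (θ t).2)

open Classical in
/-- The First-Opt mechanism with sample size `s`: NOT for the first `s` candidates, then HIRE for the
first candidate that is best so far for either player, or for the last candidate if there was no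
HIRE before. After a HIRE signal the mechanism ends (only NOT from then on). -/
noncomputable def firstOpt (n s : ℕ) : Mechanism n where
  hire t θ σ :=
    if ∃ r < t, σ r = true then 0
    else if t.val + 1 = n then 1
    else if t.val < s then 0
    else if BestSoFar θ t then 1
    else 0
  hire_nonneg t θ σ := by split_ifs <;> norm_num
  hire_le_one t θ σ := by split_ifs <;> norm_num
  causal t θ θ' σ σ' hθ hσ := by
    have h1 : (∃ r < t, σ r = true) ↔ ∃ r < t, σ' r = true :=
      exists_congr fun r => and_congr_right fun hr => by rw [hσ r hr]
    have h2 : BestSoFar θ t ↔ BestSoFar θ' t := by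
      unfold BestSoFar
      rw [hθ t le_rfl]
      exact or_congr (forall₂_congr fun r hr => by rw [hθ r hr])
        (forall₂_congr fun r hr => by rw [hθ r hr])
    simp only [h1, h2]

end SecretaryPersuasion

/-! Upper bound. Under negative correlation the two rankings are reverse to each other, so a
mechanism that ignores cardinal values decides in round `t` by the relative order of the first `t +
1` candidates. This order is independent of which candidates they are. Hence a candidate that is
best so far for the sender is her overall best with probability `(t + 1) / n`
(`OrdinalUpTo.sum_best`). If `x t / n` is the probability of hiring c_S in round `t`, then the first
HIRE falls in round `t` on a sender-record with probability `x t / (t + 1)`.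

Persuasiveness doubles this cost. Suppose that the `t` rejected candidates are, apart from c_R, the
worst ones for the sender. Then c_R would be a receiver-record, and every other remaining candidate
would be a sender-record with one and the same relative order. Since c_R is equally likely to arrive
now and last, and the receiver may wait for the last candidate, HIRE must be at least as likely on
the receiver-record as on the sender-record, for each order of the rejected candidates
(`Mechanism.PersuasiveOn.firstHire_le_swap`, `Mechanism.PersuasiveOn.sum_best_le`). For `t ≥ 1` the
two kinds of records exclude each other, so `x t` uses up `2 / (t + 1) * x t` of the probability `q
t` that nobody has been hired yet. Moreover `x t ≤ q t`. The resulting linear program has value `s *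
(n - s) / (n - 1)` with `s = n / 2` (`sum_le_of_budget`), and First-Opt makes all relevant
inequalities tight (`sum_eq_of_budget`).

Persuasiveness of First-Opt, on any instance, is a counting argument. The arrival orders in which a
deviation wins are mapped injectively to orders in which obedience wins, by moving c_R first to the
last round and then to the round of the HIRE signal (`firstOpt_persuasiveOn`). -/

namespace SecretaryPersuasion

open Finset

/-! ### Signal sequences and the first HIRE signal -/

/-- The total weight of the signal sequences that start with given signals, when the signals are
drawn one after the other. -/
theorem sum_prod_of_causal {n : ℕ} (h : Fin n → (Fin n → Bool) → ℝ)
    (hh : ∀ t σ σ', (∀ r < t, σ r = σ' r) → h t σ = h t σ') (k : ℕ) (hk : k ≤ n)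
    (σ₀ : Fin n → Bool) :
    ∑ σ : Fin n → Bool, (if ∀ r : Fin n, r.val < k → σ r = σ₀ r then
      ∏ t, (if σ t = true then h t σ else 1 - h t σ) else 0) =
    ∏ t with t.val < k, (if σ₀ t = true then h t σ₀ else 1 - h t σ₀) := by
  -- At `k = n` only `σ₀` itself contributes. Going down, the sum splits by the signal in round `k`,
  -- and the two factors `h` and `1 - h` add up to one.
  induction hk using Nat.decreasingInduction generalizing σ₀ with
  | self =>
    rw [Finset.sum_eq_single σ₀]
    · simp
    · intro σ _ hσ
      rw [if_neg]
      intro H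
      exact hσ (funext fun r => H r r.2)
    · simp
  | of_succ k hk ih =>
    have hk : k < n := by omega
    set i : Fin n := ⟨k, hk⟩ with hi
    have key : ∀ b : Bool, ∏ t with t.val < k + 1, (if Function.update σ₀ i b t = true
        then h t (Function.update σ₀ i b) else 1 - h t (Function.update σ₀ i b)) =
        (if b = true then h i σ₀ else 1 - h i σ₀) *
          ∏ t with t.val < k, (if σ₀ t = true then h t σ₀ else 1 - h t σ₀) := by
      intro b
      have e : (univ.filter fun t : Fin n => t.val < k + 1) =
          insert i (univ.filter fun t : Fin n => t.val < k) := by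
        ext t
        simp only [mem_filter, mem_univ, true_and, mem_insert, Fin.ext_iff, hi]
        omega
      have hne : ∀ r : Fin n, r.val < k → r ≠ i := by
        rintro r hr rfl
        simp [hi] at hr
      rw [e, prod_insert (by simp [hi])]
      congr 1
      · rw [Function.update_self, hh i (Function.update σ₀ i b) σ₀]
        intro r hr
        exact Function.update_of_ne hr.ne _ _
      · refine prod_congr rfl fun t ht => ?_
        rw [mem_filter] at ht
        rw [Function.update_of_ne (hne t ht.2), hh t (Function.update σ₀ i b) σ₀]
        intro r hr
        exact Function.update_of_ne (hne r (lt_trans hr ht.2)) _ _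
    have split : ∀ σ : Fin n → Bool, ∀ b : Bool, σ i = b →
        ((∀ r : Fin n, r.val < k + 1 → σ r = Function.update σ₀ i b r) ↔
          ∀ r : Fin n, r.val < k → σ r = σ₀ r) ∧
        ¬ ∀ r : Fin n, r.val < k + 1 → σ r = Function.update σ₀ i (!b) r := by
      intro σ b hb
      refine ⟨⟨fun H r hr => ?_, fun H r hr => ?_⟩, fun H => ?_⟩
      · have hri : r ≠ i := by
          rintro rfl
          simp [hi] at hr
        rw [H r (by omega), Function.update_of_ne hri]
      · by_cases hri : r = i
        · subst hri
          rw [hb, Function.update_self]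
        · rw [Function.update_of_ne hri]
          refine H r ?_
          have : r.val ≠ k := fun h' => hri (Fin.ext h')
          omega
      · have := H i (by simp [hi])
        rw [Function.update_self, hb] at this
        cases b <;> simp at this
    have h1 := ih (Function.update σ₀ i true)
    have h2 := ih (Function.update σ₀ i false)
    rw [key] at h1 h2
    simp only [if_true, Bool.false_eq_true, if_false] at h1 h2
    refine Eq.trans ?_ ((congrArg₂ (· + ·) h1 h2).trans (by ring))
    rw [← sum_add_distrib]
    refine sum_congr rfl fun σ _ => ?_
    cases hb : σ i
    · obtain ⟨A, B⟩ := split σ false hb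
      rw [if_neg (c := ∀ r : Fin n, r.val < k + 1 → σ r = Function.update σ₀ i true r) B, zero_add]
      simp only [A]
    · obtain ⟨A, B⟩ := split σ true hb
      rw [if_neg (c := ∀ r : Fin n, r.val < k + 1 → σ r = Function.update σ₀ i false r) B, add_zero]
      simp only [A]

/-- The probability that the first `k` signals are NOT when the candidates arrive in the order
`π`. -/
noncomputable def Mechanism.noHire {n : ℕ} (φ : Mechanism n) (I : Candidates n) (k : ℕ)
    (π : Equiv.Perm (Fin n)) : ℝ :=
  ∏ r with r.val < k, (1 - φ.hire r (I.arrivals π) fun _ => false)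

/-- The probability that the first HIRE signal is sent in round `t` when the candidates arrive in
the order `π`. -/
noncomputable def Mechanism.firstHire {n : ℕ} (φ : Mechanism n) (I : Candidates n) (t : Fin n)
    (π : Equiv.Perm (Fin n)) : ℝ :=
  φ.noHire I t π * φ.hire t (I.arrivals π) fun _ => false

section

variable {n : ℕ} (φ : Mechanism n) (I : Candidates n)

theorem Mechanism.noHire_zero (π : Equiv.Perm (Fin n)) : φ.noHire I 0 π = 1 := by
  simp [noHire]

theorem filter_val_lt_succ (t : Fin n) :
    (univ.filter fun r : Fin n => r.val < t.val + 1) =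
      insert t (univ.filter fun r : Fin n => r.val < t.val) := by
  ext r
  simp only [mem_filter, mem_univ, true_and, mem_insert, Fin.ext_iff]
  omega

theorem Mechanism.noHire_succ (t : Fin n) (π : Equiv.Perm (Fin n)) :
    φ.noHire I (t + 1) π = φ.noHire I t π - φ.firstHire I t π := by
  rw [noHire, filter_val_lt_succ, prod_insert (by simp), firstHire, noHire]
  ring

theorem Mechanism.noHire_nonneg (k : ℕ) (π : Equiv.Perm (Fin n)) : 0 ≤ φ.noHire I k π :=
  prod_nonneg fun r _ => sub_nonneg.2 (φ.hire_le_one r _ _)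

theorem Mechanism.firstHire_nonneg (t : Fin n) (π : Equiv.Perm (Fin n)) :
    0 ≤ φ.firstHire I t π :=
  mul_nonneg (φ.noHire_nonneg I _ _) (φ.hire_nonneg _ _ _)

theorem Mechanism.firstHire_le (t : Fin n) (π : Equiv.Perm (Fin n)) :
    φ.firstHire I t π ≤ φ.noHire I t π :=
  mul_le_of_le_one_right (φ.noHire_nonneg I _ _) (φ.hire_le_one _ _ _)

/-- The probability of all signal sequences whose first HIRE is in round `t`. -/
theorem Mechanism.sum_prob_firstHire (t : Fin n) (π : Equiv.Perm (Fin n)) :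
    ∑ σ : Fin n → Bool, (if σ t = true ∧ ∀ r < t, σ r = false then φ.prob I π σ else 0) =
      1 / (n.factorial : ℝ) * φ.firstHire I t π := by
  have key := sum_prod_of_causal (fun r σ => φ.hire r (I.arrivals π) σ)
    (fun r σ σ' h => φ.causal r _ _ _ _ (fun _ _ => rfl) h) (t + 1) t.2 (fun r => decide (r = t))
  have e1 : ∀ σ : Fin n → Bool, (∀ r : Fin n, r.val < t.val + 1 → σ r = decide (r = t)) ↔
      (σ t = true ∧ ∀ r < t, σ r = false) := by
    intro σ
    constructor
    · intro H
      refine ⟨by simpa using H t (by omega), fun r hr => ?_⟩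
      rw [H r (by have := Fin.lt_def.1 hr; omega)]
      simpa using hr.ne
    · rintro ⟨H1, H2⟩ r hr
      rcases eq_or_ne r t with rfl | hrt
      · simpa using H1
      · rw [H2 r (lt_of_le_of_ne (Fin.le_def.2 (by omega)) hrt)]
        simpa using hrt
  have e2 : ∏ r with r.val < t.val + 1, (if decide (r = t) = true then
      φ.hire r (I.arrivals π) (fun r => decide (r = t)) else
      1 - φ.hire r (I.arrivals π) (fun r => decide (r = t))) = φ.firstHire I t π := by
    rw [filter_val_lt_succ, prod_insert (by simp), firstHire, noHire, mul_comm]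
    congr 1
    · refine prod_congr rfl fun r hr => ?_
      have hr : r < t := by simpa using hr
      rw [if_neg (by simpa using hr.ne)]
      congr 1
      refine φ.causal _ _ _ _ _ (fun _ _ => rfl) fun u hu => ?_
      simpa using (hu.trans hr).ne
    · rw [if_pos (by simp)]
      refine φ.causal _ _ _ _ _ (fun _ _ => rfl) fun u hu => ?_
      simpa using hu.ne
  rw [← e2, ← key, mul_sum]
  refine sum_congr rfl fun σ _ => ?_
  simp only [e1, Mechanism.prob, mul_ite, mul_zero]

/-- The success probability of the sender, by the round of the first HIRE signal. -/
theorem Mechanism.senderSuccess_eq (c : Fin n) (hc : ∀ j, I.xi j ≤ I.xi c) :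
    φ.senderSuccess I = 1 / (n.factorial : ℝ) *
      ∑ t, ∑ π : Equiv.Perm (Fin n), if π t = c then φ.firstHire I t π else 0 := by
  classical
  rw [senderSuccess, sum_comm (s := (univ : Finset (Fin n))), mul_sum]
  refine sum_congr rfl fun π _ => ?_
  have e : ∀ σ : Fin n → Bool,
      (if (obedient n).HiresBestFrom 0 I.xi π σ then φ.prob I π σ else 0) =
      ∑ t, if π t = c then (if σ t = true ∧ ∀ r < t, σ r = false then φ.prob I π σ else 0)
        else 0 := by
    intro σ
    have hb : ∀ t, (∀ j, I.xi j ≤ I.xi (π t)) ↔ π t = c := fun t =>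
      ⟨fun h => I.xi_injective (le_antisymm (hc _) (h c)), fun h => h ▸ hc⟩
    rw [sum_eq_single (π.symm c)]
    · simp only [Equiv.apply_symm_apply, if_true]
      refine if_congr ?_ rfl rfl
      constructor
      · rintro ⟨t, -, h1, h2, h3⟩
        rw [hb] at h3
        obtain rfl : t = π.symm c := by rw [← h3, Equiv.symm_apply_apply]
        exact ⟨h1, fun r hr => by simpa [obedient] using h2 r hr (Nat.zero_le _)⟩
      · rintro ⟨h1, h2⟩
        exact ⟨π.symm c, Nat.zero_le _, h1, fun r hr _ => by simp [obedient, h2 r hr], by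
          rw [hb, Equiv.apply_symm_apply]⟩
    · intro t _ ht
      rw [if_neg]
      rintro rfl
      simp at ht
    · simp
  simp only [e]
  rw [sum_comm, mul_sum]
  refine sum_congr rfl fun t _ => ?_
  split_ifs
  · exact φ.sum_prob_firstHire I t π
  · simp

end

/-! ### Independence of relative order and identity of the candidates -/

/-- `f π` depends only on the ranking with respect to `v` of the candidates that arrive in the
first `k` rounds. -/
def OrdinalUpTo {n : ℕ} (v : Fin n → ℝ) (k : ℕ) (f : Equiv.Perm (Fin n) → ℝ) : Prop :=
  ∀ π π' : Equiv.Perm (Fin n),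
    (∀ r s : Fin n, r.val < k → s.val < k → (v (π r) < v (π s) ↔ v (π' r) < v (π' s))) →
    f π = f π'

/-- The permutations of the first `k` rounds. -/
def prefixPerms (n k : ℕ) : Finset (Equiv.Perm (Fin n)) :=
  univ.filter fun τ => ∀ r : Fin n, k ≤ r.val → τ r = r

section

variable {n : ℕ} {v : Fin n → ℝ} {k : ℕ}

theorem mem_prefixPerms {τ : Equiv.Perm (Fin n)} :
    τ ∈ prefixPerms n k ↔ ∀ r : Fin n, k ≤ r.val → τ r = r := by
  simp [prefixPerms]

theorem apply_val_lt_of_mem_prefixPerms {τ : Equiv.Perm (Fin n)} (hτ : τ ∈ prefixPerms n k)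
    {r : Fin n} (hr : r.val < k) : (τ r).val < k := by
  by_contra h
  have := τ.injective (mem_prefixPerms.1 hτ (τ r) (not_lt.1 h))
  omega

theorem mul_mem_prefixPerms {τ τ' : Equiv.Perm (Fin n)} (hτ : τ ∈ prefixPerms n k)
    (hτ' : τ' ∈ prefixPerms n k) : τ * τ' ∈ prefixPerms n k := by
  rw [mem_prefixPerms] at *
  intro r hr
  rw [Equiv.Perm.mul_apply, hτ' r hr, hτ r hr]

theorem inv_mem_prefixPerms {τ : Equiv.Perm (Fin n)} (hτ : τ ∈ prefixPerms n k) :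
    τ⁻¹ ∈ prefixPerms n k := by
  rw [mem_prefixPerms] at *
  intro r hr
  rw [Equiv.Perm.inv_eq_iff_eq, hτ r hr]

theorem one_mem_prefixPerms : (1 : Equiv.Perm (Fin n)) ∈ prefixPerms n k := by
  simp [mem_prefixPerms]

/-- The first `k` candidates can be sorted by permuting the first `k` rounds. -/
theorem exists_prefixPerms_sort (hv : Function.Injective v) (hk : k ≤ n)
    (π : Equiv.Perm (Fin n)) : ∃ τ ∈ prefixPerms n k, ∀ r s : Fin n, r.val < k → s.val < k →
      (v ((π * τ) r) < v ((π * τ) s) ↔ r < s) := by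
  let e : Fin k ≃ {r : Fin n // r.val < k} :=
    { toFun := fun i => ⟨⟨i, by omega⟩, i.2⟩
      invFun := fun r => ⟨r.1.1, r.2⟩
      left_inv := fun _ => rfl
      right_inv := fun _ => rfl }
  let w : Fin k → ℝ := fun i => v (π (e i))
  have hmono : StrictMono (w ∘ Tuple.sort w) :=
    (Tuple.monotone_sort w).strictMono_of_injective
      ((hv.comp (π.injective.comp (Subtype.val_injective.comp e.injective))).comp
        (Tuple.sort w).injective)
  refine ⟨(Tuple.sort w).extendDomain e, mem_prefixPerms.2 fun r hr =>
    Equiv.Perm.extendDomain_apply_not_subtype _ _ (not_lt.2 hr), fun r s hr hs => ?_⟩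
  have hr' : ((e ⟨r, hr⟩ : {r : Fin n // r.val < k}) : Fin n) = r := rfl
  have hs' : ((e ⟨s, hs⟩ : {r : Fin n // r.val < k}) : Fin n) = s := rfl
  have h := hmono.lt_iff_lt (a := ⟨r, hr⟩) (b := ⟨s, hs⟩)
  rw [Equiv.Perm.mul_apply, Equiv.Perm.mul_apply]
  conv_lhs => rw [← hr', ← hs']
  rw [Equiv.Perm.extendDomain_apply_image, Equiv.Perm.extendDomain_apply_image]
  exact h

/-- Every left coset of `prefixPerms n k` contains an arrangement with sorted prefix. With both
cosets based at such an arrangement, corresponding members have the same relative order, so the sums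
agree term by term. -/
theorem OrdinalUpTo.sum_prefixPerms_eq {f : Equiv.Perm (Fin n) → ℝ} (hf : OrdinalUpTo v k f)
    (hv : Function.Injective v) (hk : k ≤ n) (π π' : Equiv.Perm (Fin n)) :
    ∑ τ ∈ prefixPerms n k, f (π * τ) = ∑ τ ∈ prefixPerms n k, f (π' * τ) := by
  obtain ⟨τ₁, h₁, hs₁⟩ := exists_prefixPerms_sort hv hk π
  obtain ⟨τ₂, h₂, hs₂⟩ := exists_prefixPerms_sort hv hk π'
  have shift : ∀ (π τ₁ : Equiv.Perm (Fin n)), τ₁ ∈ prefixPerms n k →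
      ∑ τ ∈ prefixPerms n k, f (π * τ) = ∑ τ ∈ prefixPerms n k, f (π * τ₁ * τ) := by
    intro π τ₁ h₁
    refine (sum_nbij' (fun τ => τ₁ * τ) (fun τ => τ₁⁻¹ * τ)
      (fun τ hτ => mul_mem_prefixPerms h₁ hτ)
      (fun τ hτ => mul_mem_prefixPerms (inv_mem_prefixPerms h₁) hτ) ?_ ?_ ?_).symm
    · intro τ _; simp
    · intro τ _; simp
    · intro τ _; simp [mul_assoc]
  rw [shift π τ₁ h₁, shift π' τ₂ h₂]
  refine sum_congr rfl fun τ hτ => hf _ _ fun r s hr hs => ?_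
  exact (hs₁ _ _ (apply_val_lt_of_mem_prefixPerms hτ hr)
    (apply_val_lt_of_mem_prefixPerms hτ hs)).trans
    (hs₂ _ _ (apply_val_lt_of_mem_prefixPerms hτ hr) (apply_val_lt_of_mem_prefixPerms hτ hs)).symm

/-- The ranking of the first `k` candidates is independent of everything that does not depend on
their order. -/
theorem OrdinalUpTo.card_mul_sum_mul {f g : Equiv.Perm (Fin n) → ℝ} (hf : OrdinalUpTo v k f)
    (hv : Function.Injective v) (hk : k ≤ n)
    (hg : ∀ π, ∀ τ ∈ prefixPerms n k, g (π * τ) = g π) (π₁ : Equiv.Perm (Fin n)) :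
    (#(prefixPerms n k) : ℝ) * ∑ π, f π * g π =
      (∑ τ ∈ prefixPerms n k, f (π₁ * τ)) * ∑ π, g π := by
  have h1 : ∀ τ ∈ prefixPerms n k, ∑ π, f π * g π = ∑ π, f (π * τ) * g π := by
    intro τ hτ
    rw [← Equiv.sum_comp (Equiv.mulRight τ)]
    refine sum_congr rfl fun π _ => ?_
    rw [Equiv.coe_mulRight, hg π τ hτ]
  calc _ = ∑ τ ∈ prefixPerms n k, ∑ π, f (π * τ) * g π := by
        rw [← sum_congr rfl h1, sum_const, nsmul_eq_mul]
    _ = ∑ π, (∑ τ ∈ prefixPerms n k, f (π * τ)) * g π := by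
        rw [sum_comm]
        simp_rw [sum_mul]
    _ = _ := by
        rw [mul_sum]
        exact sum_congr rfl fun π _ => by rw [hf.sum_prefixPerms_eq hv hk π π₁]

theorem OrdinalUpTo.card_mul_sum {f : Equiv.Perm (Fin n) → ℝ} (hf : OrdinalUpTo v k f)
    (hv : Function.Injective v) (hk : k ≤ n) (π₁ : Equiv.Perm (Fin n)) :
    (#(prefixPerms n k) : ℝ) * ∑ π, f π =
      (n.factorial : ℝ) * ∑ τ ∈ prefixPerms n k, f (π₁ * τ) := by
  have := hf.card_mul_sum_mul (g := fun _ => 1) hv hk (fun _ _ _ => rfl) π₁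
  simp only [mul_one, sum_const, nsmul_eq_mul, card_univ, Fintype.card_perm, Fintype.card_fin]
    at this
  rw [this, mul_comm]

theorem card_prefixPerms_pos : (0 : ℝ) < #(prefixPerms n k) := by
  exact_mod_cast card_pos.2 ⟨1, one_mem_prefixPerms⟩

/-- The product rule for expectations, cleared of denominators: `f` sees only the order within a
coset and `g` only the coset. -/
theorem OrdinalUpTo.sum_mul {f g : Equiv.Perm (Fin n) → ℝ} (hf : OrdinalUpTo v k f)
    (hv : Function.Injective v) (hk : k ≤ n)
    (hg : ∀ π, ∀ τ ∈ prefixPerms n k, g (π * τ) = g π) :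
    (n.factorial : ℝ) * ∑ π, f π * g π = (∑ π, f π) * ∑ π, g π := by
  have h1 := hf.card_mul_sum_mul hv hk hg 1
  have h2 := hf.card_mul_sum hv hk 1
  refine mul_left_cancel₀ (card_prefixPerms_pos (n := n) (k := k)).ne' ?_
  linear_combination (n.factorial : ℝ) * h1 - (∑ π, g π) * h2

/-- Every candidate is equally likely to arrive in round `t`. -/
theorem card_mul_sum_apply_eq (t c : Fin n) :
    (n : ℝ) * ∑ π : Equiv.Perm (Fin n), (if π t = c then (1 : ℝ) else 0) = n.factorial := by
  have h1 : ∀ s : Fin n, ∑ π : Equiv.Perm (Fin n), (if π s = c then (1 : ℝ) else 0) =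
      ∑ π : Equiv.Perm (Fin n), (if π t = c then (1 : ℝ) else 0) := by
    intro s
    rw [← Equiv.sum_comp (Equiv.mulRight (Equiv.swap s t))]
    simp
  calc _ = ∑ s : Fin n, ∑ π : Equiv.Perm (Fin n), (if π s = c then (1 : ℝ) else 0) := by
        simp only [h1, sum_const, card_univ, Fintype.card_fin, nsmul_eq_mul]
    _ = ∑ π : Equiv.Perm (Fin n), (1 : ℝ) := by
        rw [sum_comm]
        refine sum_congr rfl fun π _ => ?_
        rw [sum_eq_single (π.symm c)]
        · simp
        · intro s _ hs
          rw [if_neg]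
          rintro rfl
          simp at hs
        · simp
    _ = _ := by simp [Fintype.card_perm]

/-- The candidate of round `t` is independent of the ranking of the earlier candidates. -/
theorem OrdinalUpTo.sum_apply_eq {f : Equiv.Perm (Fin n) → ℝ} {t : Fin n}
    (hf : OrdinalUpTo v t f) (hv : Function.Injective v) (c : Fin n) :
    (n : ℝ) * ∑ π, (if π t = c then f π else 0) = ∑ π, f π := by
  have h := hf.sum_mul (g := fun π => if π t = c then 1 else 0) hv t.2.le (by
    intro π τ hτ
    rw [Equiv.Perm.mul_apply, mem_prefixPerms.1 hτ t le_rfl])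
  have h2 := card_mul_sum_apply_eq t c
  have h3 : (n.factorial : ℝ) ≠ 0 := by positivity
  simp only [mul_ite, mul_one, mul_zero] at h
  refine mul_left_cancel₀ h3 ?_
  linear_combination (n : ℝ) * h + (∑ π, f π) * h2

theorem OrdinalUpTo.mul {f g : Equiv.Perm (Fin n) → ℝ} (hf : OrdinalUpTo v k f)
    (hg : OrdinalUpTo v k g) : OrdinalUpTo v k fun π => f π * g π := fun π π' h => by
  simp only [hf π π' h, hg π π' h]

theorem OrdinalUpTo.mono {f : Equiv.Perm (Fin n) → ℝ} {m : ℕ} (hf : OrdinalUpTo v k f)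
    (hkm : k ≤ m) : OrdinalUpTo v m f := fun π π' h =>
  hf π π' fun r s hr hs => h r s (hr.trans_le hkm) (hs.trans_le hkm)

open Classical in
theorem OrdinalUpTo.ite_best {f : Equiv.Perm (Fin n) → ℝ} {t : Fin n}
    (hf : OrdinalUpTo v (t + 1) f) :
    OrdinalUpTo v (t + 1) fun π => if ∀ r ≤ t, v (π r) ≤ v (π t) then f π else 0 := by
  intro π π' h
  have : (∀ r ≤ t, v (π r) ≤ v (π t)) ↔ ∀ r ≤ t, v (π' r) ≤ v (π' t) :=
    forall₂_congr fun r hr => by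
      rw [← not_lt, ← not_lt, h t r (by omega) (by have := Fin.le_def.1 hr; omega)]
  simp only [this, hf π π' h]

open Classical in
/-- A candidate that is best so far in round `t` is the best of all with probability
`(t + 1) / n`, independently of the ranking. -/
theorem OrdinalUpTo.sum_best {f : Equiv.Perm (Fin n) → ℝ} {t : Fin n}
    (hf : OrdinalUpTo v (t + 1) f) (hv : Function.Injective v) {c : Fin n}
    (hc : ∀ j, v j ≤ v c) :
    ((t : ℝ) + 1) * ∑ π, (if ∀ r ≤ t, v (π r) ≤ v (π t) then f π else 0) =
      n * ∑ π, (if π t = c then f π else 0) := by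
  -- The second factor is the event that `c` is among the first `t + 1` arrivals, which does not
  -- depend on their order. Together with being best so far it means that `c` arrives in round `t`.
  have h := hf.ite_best.sum_mul (g := fun π => if (π.symm c).val < t + 1 then 1 else 0) hv t.2 (by
    intro π τ hτ
    have : ((π * τ).symm c).val < t + 1 ↔ (π.symm c).val < t + 1 := by
      have e : π.symm c = τ ((π * τ).symm c) := by
        rw [Equiv.symm_apply_eq]
        exact ((π * τ).apply_symm_apply c).symm
      constructor
      · intro h
        rw [e]
        exact apply_val_lt_of_mem_prefixPerms hτ h
      · intro h
        have e' : (π * τ).symm c = τ⁻¹ (π.symm c) := by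
          rw [e]
          exact (τ.symm_apply_apply _).symm
        rw [e']
        exact apply_val_lt_of_mem_prefixPerms (inv_mem_prefixPerms hτ) h
    simp only [this])
  have h2 : (n : ℝ) * ∑ π : Equiv.Perm (Fin n), (if (π.symm c).val < t + 1 then (1 : ℝ) else 0) =
      (t + 1) * n.factorial := by
    have e : ∀ π : Equiv.Perm (Fin n), (if (π.symm c).val < t + 1 then (1 : ℝ) else 0) =
        ∑ r ∈ Iic t, if π r = c then (1 : ℝ) else 0 := by
      intro π
      have : ∀ r, π r = c ↔ r = π.symm c := fun r => by rw [Equiv.eq_symm_apply]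
      simp only [this, sum_ite_eq', mem_Iic, Fin.le_def, Nat.lt_succ_iff]
    simp only [e]
    rw [sum_comm, mul_sum, sum_congr rfl fun r _ => card_mul_sum_apply_eq r c, sum_const,
      Fin.card_Iic]
    simp
  have h3 : (n.factorial : ℝ) ≠ 0 := by positivity
  have h4 : ∀ π : Equiv.Perm (Fin n), (if ∀ r ≤ t, v (π r) ≤ v (π t) then f π else 0) *
      (if (π.symm c).val < t + 1 then 1 else 0) = if π t = c then f π else 0 := by
    intro π
    by_cases hπ : π t = c
    · have : π.symm c = t := by rw [← hπ, Equiv.symm_apply_apply]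
      rw [if_pos (fun r _ => hπ ▸ hc _), if_pos (by omega), if_pos hπ, mul_one]
    · rw [if_neg hπ]
      by_cases h5 : (π.symm c).val < t + 1
      · rw [if_neg (c := ∀ r ≤ t, v (π r) ≤ v (π t)), zero_mul]
        intro H
        have := H (π.symm c) (Fin.le_def.2 (by omega))
        rw [Equiv.apply_symm_apply] at this
        exact hπ (hv (le_antisymm (hc _) this))
      · rw [if_neg h5, mul_zero]
  simp only [h4] at h
  refine mul_left_cancel₀ h3 ?_
  linear_combination (-(n : ℝ)) * h -
    (∑ π, if ∀ r ≤ t, v (π r) ≤ v (π t) then f π else 0) * h2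

end

/-! ### The linear program for the stopping probabilities -/

/-- Let `x t / n` be the probability that the best candidate is hired in round `t`, and `q t` the
probability that nobody is hired before round `t`. If every unit of `x t` costs `2 / (t + 1)` units
of `q`, then it is best to start hiring in round `n / 2`. -/
theorem sum_le_of_budget {n : ℕ} (hn : 2 ≤ n) {x q : ℕ → ℝ} (hx : ∀ t < n, 0 ≤ x t)
    (hxq : ∀ t < n, x t ≤ q t) (h0 : q 0 = 1) (hq0 : q 1 ≤ q 0 - x 0)
    (hq : ∀ t, 1 ≤ t → t + 1 < n → q (t + 1) ≤ q t - 2 / ((t : ℝ) + 1) * x t) :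
    ∑ t ∈ range n, x t ≤ ((n / 2 : ℕ) : ℝ) * (n - (n / 2 : ℕ)) / (n - 1) := by
  have hn1 : (0 : ℝ) < n - 1 := by
    have : (2 : ℝ) ≤ n := by exact_mod_cast hn
    linarith
  set s := n / 2 with hs
  have hs1 : (1 : ℝ) ≤ s := by
    have : 1 ≤ s := by omega
    exact_mod_cast this
  have hs2 : (n : ℝ) - 1 ≤ 2 * s := by
    have : n ≤ 2 * s + 1 := by omega
    have : (n : ℝ) ≤ 2 * s + 1 := by exact_mod_cast this
    linarith
  have hs3 : 2 * (s : ℝ) ≤ n := by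
    have : 2 * s ≤ n := by omega
    exact_mod_cast this
  -- Backward induction with the value per unit of `q r`. In the late phase this value is the one
  -- obtained by `x t = q t` from round `r` on; the loss `(q r - x r) * (2 * r + 1 - n) / (n - 1)`
  -- is nonnegative because `r ≥ n / 2`.
  have upper : ∀ r ≤ n, s ≤ r → ∑ t ∈ Ico r n, x t ≤ q r * ((r : ℝ) * (n - r) / (n - 1)) := by
    intro r hr
    induction hr using Nat.decreasingInduction with
    | self => simp
    | of_succ r hr ih =>
      intro hsr
      have ih := ih (by omega)
      rw [sum_eq_sum_Ico_succ_bot hr]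
      have hsr' : (s : ℝ) ≤ r := by exact_mod_cast hsr
      have hr1 : (1 : ℝ) ≤ r := hs1.trans hsr'
      have hrn : (r : ℝ) + 1 ≤ n := by exact_mod_cast hr
      push_cast at ih
      have step : q (r + 1) * (((r : ℝ) + 1) * (n - (r + 1)) / (n - 1)) ≤
          (q r - 2 / ((r : ℝ) + 1) * x r) * (((r : ℝ) + 1) * (n - (r + 1)) / (n - 1)) := by
        -- In the last round there is no budget inequality, but the factor `n - (r + 1)` vanishes.
        rcases eq_or_lt_of_le hrn with h | h
        · rw [← h]; simp
        · refine mul_le_mul_of_nonneg_right (hq r (by exact_mod_cast hr1) (by exact_mod_cast h)) ?_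
          have : (0 : ℝ) ≤ n - (r + 1) := by linarith
          positivity
      have e : q r * ((r : ℝ) * (n - r) / (n - 1)) - (x r +
          (q r - 2 / ((r : ℝ) + 1) * x r) * (((r : ℝ) + 1) * (n - (r + 1)) / (n - 1))) =
          (q r - x r) * ((2 * r + 1 - n) / (n - 1)) := by
        have : (r : ℝ) + 1 ≠ 0 := by positivity
        field_simp
        ring
      have : 0 ≤ (q r - x r) * ((2 * r + 1 - n) / (n - 1)) :=
        mul_nonneg (sub_nonneg.2 (hxq r hr)) (div_nonneg (by linarith) hn1.le)
      linarith
  -- Needed for round `0`, where a unit of `x` costs only one unit of `q`: saving that unit is still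
  -- worth at least as much.
  have hY : (1 : ℝ) ≤ s * (n - s) / (n - 1) := by
    rw [le_div_iff₀ hn1]
    nlinarith
  -- In the early phase the value stays constant: the `2 / (r + 1)` units of `q` paid for one unit
  -- of `x r` are worth at least `1` later.
  have lower : ∀ r ≤ s, ∑ t ∈ Ico r n, x t ≤ q r * ((s : ℝ) * (n - s) / (n - 1)) := by
    intro r hr
    induction hr using Nat.decreasingInduction with
    | self => exact upper s (by omega) le_rfl
    | of_succ r hr ih =>
      rw [sum_eq_sum_Ico_succ_bot (by omega)]
      have hx := hx r (by omega)
      rcases Nat.eq_zero_or_pos r with rfl | hr0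
      · have := mul_le_mul_of_nonneg_right hq0 (zero_le_one.trans hY)
        nlinarith
      · have h1 := mul_le_mul_of_nonneg_right (hq r hr0 (by omega)) (zero_le_one.trans hY)
        have h2 : 1 ≤ 2 / ((r : ℝ) + 1) * ((s : ℝ) * (n - s) / (n - 1)) := by
          have hrs : (r : ℝ) + 1 ≤ s := by exact_mod_cast hr
          rw [div_mul_div_comm, le_div_iff₀ (by positivity)]
          nlinarith
        have h3 := mul_le_mul_of_nonneg_left h2 hx
        nlinarith
  have := lower 0 (Nat.zero_le _)
  rwa [h0, one_mul, ← range_eq_Ico] at this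

/-- The equality case of the backward induction: nothing is spent before round `n / 2`, and from
there on `x t = q t` removes the loss term. -/
theorem sum_eq_of_budget {n : ℕ} (hn : 2 ≤ n) {x q : ℕ → ℝ} (hx : ∀ t < n / 2, x t = 0)
    (h0 : q (n / 2) = 1) (hxq : ∀ t < n, n / 2 ≤ t → x t = q t)
    (hq : ∀ t, n / 2 ≤ t → t + 1 < n → q (t + 1) = q t - 2 / ((t : ℝ) + 1) * x t) :
    ∑ t ∈ range n, x t = ((n / 2 : ℕ) : ℝ) * (n - (n / 2 : ℕ)) / (n - 1) := by
  have hn1 : (n : ℝ) - 1 ≠ 0 := by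
    have : (2 : ℝ) ≤ n := by exact_mod_cast hn
    linarith
  have upper : ∀ r ≤ n, n / 2 ≤ r →
      ∑ t ∈ Ico r n, x t = q r * ((r : ℝ) * (n - r) / (n - 1)) := by
    intro r hr
    induction hr using Nat.decreasingInduction with
    | self => simp
    | of_succ r hr ih =>
      intro hsr
      rw [sum_eq_sum_Ico_succ_bot hr, ih (by omega), hxq r hr hsr]
      have : (r : ℝ) + 1 ≠ 0 := by positivity
      rcases eq_or_lt_of_le (show r + 1 ≤ n from hr) with h | h
      · subst h
        push_cast at hn1 ⊢
        field_simp
        ring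
      · rw [hq r hsr h, hxq r hr hsr]
        push_cast
        field_simp
        ring
  rw [range_eq_Ico, ← sum_Ico_consecutive x (Nat.zero_le _) (Nat.div_le_self n 2),
    sum_eq_zero fun t ht => hx t (mem_Ico.1 ht).2, zero_add, upper _ (Nat.div_le_self n 2) le_rfl,
    h0, one_mul]

/-! ### Negative correlation and the upper bound -/

theorem rank_lt_rank {n : ℕ} {v : Fin n → ℝ} {i j : Fin n} (h : v i < v j) :
    rank v j < rank v i := by
  refine card_lt_card ⟨fun a ha => ?_, fun H => ?_⟩
  · simp only [mem_filter, mem_univ, true_and] at ha ⊢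
    exact h.le.trans ha
  · have := H (show i ∈ _ by simp)
    simp only [mem_filter, mem_univ, true_and] at this
    exact absurd this (not_le.2 h)

section

variable {n : ℕ} {I : Candidates n}

theorem Candidates.NegativelyCorrelated.rho_lt_iff (hI : I.NegativelyCorrelated) (i j : Fin n) :
    I.rho i < I.rho j ↔ I.xi j < I.xi i := by
  have hi := hI i
  have hj := hI j
  constructor
  · intro h
    have h1 := rank_lt_rank h
    by_contra h2
    rcases (not_lt.1 h2).lt_or_eq with h3 | h3
    · have := rank_lt_rank h3
      omega
    · rw [I.xi_injective h3] at h
      exact lt_irrefl _ h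
  · intro h
    have h1 := rank_lt_rank h
    by_contra h2
    rcases (not_lt.1 h2).lt_or_eq with h3 | h3
    · have := rank_lt_rank h3
      omega
    · rw [I.rho_injective h3] at h
      exact lt_irrefl _ h

theorem Candidates.NegativelyCorrelated.rho_le_iff (hI : I.NegativelyCorrelated) (i j : Fin n) :
    I.rho i ≤ I.rho j ↔ I.xi j ≤ I.xi i := by
  rw [← not_lt, ← not_lt, hI.rho_lt_iff]

theorem OrdinalUpTo.rho (hI : I.NegativelyCorrelated) {k : ℕ} {f : Equiv.Perm (Fin n) → ℝ}
    (hf : OrdinalUpTo I.xi k f) : OrdinalUpTo I.rho k f := fun π π' h =>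
  hf π π' fun r s hr hs => by
    rw [← hI.rho_lt_iff, ← hI.rho_lt_iff, h s r hs hr]

variable {φ : Mechanism n}

theorem Mechanism.IgnoresCardinalValues.ordinalUpTo_hire (hφ : φ.IgnoresCardinalValues)
    (hI : I.NegativelyCorrelated) (t : Fin n) (σ : Fin n → Bool) :
    OrdinalUpTo I.xi (t + 1) fun π => φ.hire t (I.arrivals π) σ := fun π π' h =>
  hφ t _ _ σ fun r hr s hs => by
    have hr : r.val < t + 1 := Nat.lt_succ_of_le hr
    have hs : s.val < t + 1 := Nat.lt_succ_of_le hs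
    refine ⟨h r s hr hs, ?_⟩
    simp only [Candidates.arrivals, hI.rho_lt_iff]
    exact h s r hs hr

theorem Mechanism.IgnoresCardinalValues.ordinalUpTo_noHire (hφ : φ.IgnoresCardinalValues)
    (hI : I.NegativelyCorrelated) (k : ℕ) : OrdinalUpTo I.xi k (φ.noHire I k) := fun π π' h =>
  prod_congr rfl fun r hr => by
    rw [mem_filter] at hr
    exact congrArg (fun x => 1 - x) (((hφ.ordinalUpTo_hire hI r fun _ => false).mono hr.2) π π' h)

theorem Mechanism.IgnoresCardinalValues.ordinalUpTo_firstHire (hφ : φ.IgnoresCardinalValues)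
    (hI : I.NegativelyCorrelated) (t : Fin n) : OrdinalUpTo I.xi (t + 1) (φ.firstHire I t) :=
  ((hφ.ordinalUpTo_noHire hI t).mono (Nat.le_succ _)).mul (hφ.ordinalUpTo_hire hI t _)

/-- The success probability of a receiver who upon the first HIRE in round `t` hires for sure in
round `u`. -/
theorem Mechanism.receiverSuccessAt_firstHire (φ : Mechanism n) (t u : Fin n)
    (π₀ : Equiv.Perm (Fin n)) (τ : ReceiverStrategy n) {c : Fin n} (hc : ∀ j, I.rho j ≤ I.rho c)
    (htu : t ≤ u)
    (hτ : ∀ π σ, σ t = true → τ.hires u π σ ∧ ∀ r < u, t ≤ r → ¬ τ.hires r π σ) :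
    φ.receiverSuccessAt I t π₀ (fun r => decide (r = t)) τ =
      ∑ π, if (∀ r < t, π r = π₀ r) ∧ π u = c
        then 1 / (n.factorial : ℝ) * φ.firstHire I t π else 0 := by
  classical
  refine sum_congr rfl fun π _ => ?_
  rw [← φ.sum_prob_firstHire I t π]
  have e1 : ∀ σ : Fin n → Bool, (∀ r ≤ t, σ r = decide (r = t)) ↔
      (σ t = true ∧ ∀ r < t, σ r = false) := by
    intro σ
    constructor
    · intro H
      refine ⟨by simpa using H t le_rfl, fun r hr => ?_⟩
      rw [H r hr.le]
      simpa using hr.ne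
    · rintro ⟨H1, H2⟩ r hr
      rcases eq_or_lt_of_le hr with rfl | hrt
      · simpa using H1
      · rw [H2 r hrt]
        simpa using hrt.ne
  have e2 : ∀ σ : Fin n → Bool, σ t = true → (τ.HiresBestFrom t I.rho π σ ↔ π u = c) := by
    intro σ hσ
    obtain ⟨h1, h2⟩ := hτ π σ hσ
    constructor
    · rintro ⟨w, hw, h3, h4, h5⟩
      obtain rfl : w = u := by
        rcases lt_trichotomy w u with h | h | h
        · exact absurd h3 (h2 w h (Fin.le_def.2 hw))
        · exact h
        · exact absurd h1 (h4 u h htu)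
      exact I.rho_injective (le_antisymm (hc _) (h5 c))
    · rintro h
      exact ⟨u, htu, h1, fun r hr hr' => h2 r hr (Fin.le_def.2 hr'), h ▸ hc⟩
  split_ifs with hp
  · refine sum_congr rfl fun σ _ => ?_
    exact if_congr ⟨fun h => (e1 σ).1 h.2.1, fun h => ⟨hp.1, (e1 σ).2 h, (e2 σ h.1).2 hp.2⟩⟩
      rfl rfl
  · refine sum_eq_zero fun σ _ => if_neg fun h => hp ⟨h.1, ?_⟩
    exact (e2 σ (by simpa using h.2.1 t le_rfl)).1 h.2.2

/-- If a HIRE signal in round `t` is to be obeyed for a candidate better than all earlier ones for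
the sender, then it is at least as likely for a candidate that is better for the receiver. -/
theorem Mechanism.PersuasiveOn.firstHire_le_swap (hφ : φ.IgnoresCardinalValues)
    (hP : φ.PersuasiveOn I) (hI : I.NegativelyCorrelated) {t l : Fin n} (htl : t < l)
    (hl : ∀ r, r ≤ l) {π₀ : Equiv.Perm (Fin n)} (hmin : ∀ j, I.rho j ≤ I.rho (π₀ l))
    (hlow : ∀ r s, r < t → t ≤ s → s < l → I.xi (π₀ r) < I.xi (π₀ s)) :
    φ.firstHire I t π₀ ≤ φ.firstHire I t (π₀ * Equiv.swap t l) := by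
  classical
  -- The deviation: ignore HIRE and take the last candidate.
  let τ : ReceiverStrategy n := ⟨fun u _ _ => u = l, fun _ _ _ _ _ _ _ => Iff.rfl⟩
  have h := hP t π₀ (fun r => decide (r = t)) (fun r hr => by simpa using hr.ne) τ
  rw [φ.receiverSuccessAt_firstHire t l π₀ τ hmin htl.le
      (fun π σ _ => ⟨rfl, fun r hr _ => hr.ne⟩),
    φ.receiverSuccessAt_firstHire t t π₀ (obedient n) hmin le_rfl
      (fun π σ hσ => ⟨hσ, fun r hr hr' => absurd hr (not_lt.2 hr')⟩)] at h
  have hsw : ∀ r < t, Equiv.swap t l r = r := fun r hr =>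
    Equiv.swap_apply_of_ne_of_ne hr.ne (hr.trans htl).ne
  -- If c_R comes last, then by `hlow` whoever arrives in round `t` is better for the sender than
  -- all rejected candidates. The relative order, and hence `firstHire`, is thus the same for all
  -- these `π`.
  have e1 : ∀ π : Equiv.Perm (Fin n), (if (∀ r < t, π r = π₀ r) ∧ π l = π₀ l
        then 1 / (n.factorial : ℝ) * φ.firstHire I t π else 0) =
      (if (∀ r < t, π r = π₀ r) ∧ π l = π₀ l then 1 else 0) *
        (1 / (n.factorial : ℝ) * φ.firstHire I t π₀) := by
    intro π
    split_ifs with hπ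
    · obtain ⟨h1, h2⟩ := hπ
      rw [one_mul]
      congr 1
      have hlt : ∀ r < t, I.xi (π₀ r) < I.xi (π t) := by
        intro r hr
        obtain ⟨u, hu⟩ := π₀.surjective (π t)
        rw [← hu]
        refine hlow r u hr (not_lt.1 fun hut => ?_) (lt_of_le_of_ne (hl u) fun hul => ?_)
        · rw [← h1 u hut] at hu
          exact hut.ne (π.injective hu)
        · rw [hul, ← h2] at hu
          exact htl.ne' (π.injective hu)
      refine hφ.ordinalUpTo_firstHire hI t π π₀ fun r s hr hs => ?_
      rcases eq_or_lt_of_le (show r ≤ t from Nat.le_of_lt_succ hr) with rfl | hr <;>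
        rcases eq_or_lt_of_le (show s ≤ _ from Nat.le_of_lt_succ hs) with rfl | hs
      · simp
      · rw [h1 s hs]
        exact iff_of_false (hlt s hs).not_gt (hlow s _ hs le_rfl htl).not_gt
      · rw [h1 r hr]
        exact iff_of_true (hlt r hr) (hlow r _ hr le_rfl htl)
      · rw [h1 r hr, h1 s hs]
    · simp
  -- Exchanging rounds `t` and `l` turns the orders in which obedience wins into those with c_R
  -- last. Both sides then carry the same positive count, which cancels.
  have e2 : ∀ π : Equiv.Perm (Fin n), (if (∀ r < t, (π * Equiv.swap t l) r = π₀ r) ∧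
        (π * Equiv.swap t l) t = π₀ l
        then 1 / (n.factorial : ℝ) * φ.firstHire I t (π * Equiv.swap t l) else 0) =
      (if (∀ r < t, π r = π₀ r) ∧ π l = π₀ l then 1 else 0) *
        (1 / (n.factorial : ℝ) * φ.firstHire I t (π₀ * Equiv.swap t l)) := by
    intro π
    have e3 : ((∀ r < t, (π * Equiv.swap t l) r = π₀ r) ∧ (π * Equiv.swap t l) t = π₀ l) ↔
        ((∀ r < t, π r = π₀ r) ∧ π l = π₀ l) := by
      refine and_congr (forall₂_congr fun r hr => ?_) ?_
      · rw [Equiv.Perm.mul_apply, hsw r hr]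
      · rw [Equiv.Perm.mul_apply, Equiv.swap_apply_left]
    simp only [e3]
    split_ifs with hπ
    · rw [one_mul]
      congr 1
      have e4 : ∀ r : Fin n, r.val < t + 1 →
          (π * Equiv.swap t l) r = (π₀ * Equiv.swap t l) r := by
        intro r hr
        rw [Equiv.Perm.mul_apply, Equiv.Perm.mul_apply]
        rcases eq_or_lt_of_le (show r ≤ t from Nat.le_of_lt_succ hr) with rfl | hr
        · rw [Equiv.swap_apply_left, hπ.2]
        · rw [hsw r hr, hπ.1 r hr]
      refine hφ.ordinalUpTo_firstHire hI t _ _ fun r s hr hs => ?_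
      rw [e4 r hr, e4 s hs]
    · simp
  have e5 := (sum_congr rfl fun π _ => (e2 π).symm).trans
    (Equiv.sum_comp (Equiv.mulRight (Equiv.swap t l)) fun π : Equiv.Perm (Fin n) =>
      if (∀ r < t, π r = π₀ r) ∧ π t = π₀ l
        then 1 / (n.factorial : ℝ) * φ.firstHire I t π else 0)
  rw [← e5, sum_congr rfl fun π _ => e1 π, ← sum_mul,
    ← sum_mul] at h
  have hpos : (0 : ℝ) < ∑ π : Equiv.Perm (Fin n),
      if (∀ r < t, π r = π₀ r) ∧ π l = π₀ l then 1 else 0 :=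
    sum_pos' (fun π _ => by split_ifs <;> norm_num) ⟨π₀, mem_univ _, by simp⟩
  have h := le_of_mul_le_mul_left h hpos
  exact le_of_mul_le_mul_left h (by positivity)

-- By ordinality each side can be computed on a single coset of `prefixPerms n (t + 1)`, and the two
-- cosets may be chosen differently. They are chosen such that
-- `Mechanism.PersuasiveOn.firstHire_le_swap` compares them term by term.
open Classical in
theorem Mechanism.PersuasiveOn.sum_best_le (hφ : φ.IgnoresCardinalValues)
    (hP : φ.PersuasiveOn I) (hI : I.NegativelyCorrelated) {t : Fin n} (ht : t.val + 1 < n) :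
    ∑ π, (if ∀ r ≤ t, I.xi (π r) ≤ I.xi (π t) then φ.firstHire I t π else 0) ≤
      ∑ π, (if ∀ r ≤ t, I.rho (π r) ≤ I.rho (π t) then φ.firstHire I t π else 0) := by
  -- `π₁` lists the candidates by increasing sender value, except that the worst one, who is c_R, is
  -- rotated to the end.
  obtain ⟨l, hl, π₁, hmono, hmin⟩ : ∃ l : Fin n, (∀ r, r ≤ l) ∧ ∃ π₁ : Equiv.Perm (Fin n),
      (∀ r s, r < s → s < l → I.xi (π₁ r) < I.xi (π₁ s)) ∧ ∀ j, I.xi (π₁ l) ≤ I.xi j := by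
    have hs : StrictMono (I.xi ∘ Tuple.sort I.xi) :=
      (Tuple.monotone_sort I.xi).strictMono_of_injective
        (I.xi_injective.comp (Tuple.sort I.xi).injective)
    obtain ⟨m, rfl⟩ : ∃ m, n = m + 1 := ⟨n - 1, by omega⟩
    have hrot : ∀ r < Fin.last m, (finRotate (m + 1) r).val = r.val + 1 := by
      intro r hr
      have := finRotate_of_lt (n := m) (k := r) hr
      rw [Fin.eta] at this
      rw [this]
    refine ⟨Fin.last m, Fin.le_last, Tuple.sort I.xi * finRotate (m + 1), fun r s hrs hs' => ?_,
      fun j => ?_⟩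
    · refine hs (Fin.lt_def.2 ?_)
      rw [hrot r (hrs.trans hs'), hrot s hs']
      exact Nat.succ_lt_succ hrs
    · obtain ⟨i, rfl⟩ := (Tuple.sort I.xi).surjective j
      rw [Equiv.Perm.mul_apply, finRotate_last]
      exact hs.monotone (Fin.zero_le i)
  have htl : t < l := lt_of_lt_of_le (Fin.lt_def.2 (Nat.lt_succ_self t))
    (hl ⟨t.val + 1, ht⟩)
  have ho := hφ.ordinalUpTo_firstHire hI t
  have h1 := ho.ite_best.card_mul_sum I.xi_injective t.2 π₁
  have h2 := (ho.rho hI).ite_best.card_mul_sum I.rho_injective t.2 (π₁ * Equiv.swap t l)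
  refine le_of_mul_le_mul_left ?_ (card_prefixPerms_pos (n := n) (k := t + 1))
  rw [h1, h2]
  refine mul_le_mul_of_nonneg_left (sum_le_sum fun τ hτ => ?_) (by positivity)
  have hτ' := mem_prefixPerms.1 hτ
  have hle : ∀ r ≤ t, τ r ≤ t := fun r hr =>
    Nat.le_of_lt_succ (apply_val_lt_of_mem_prefixPerms hτ (Nat.lt_succ_of_le hr))
  by_cases htt : τ t = t
  -- Sender-records in this coset are exactly the terms with `τ t = t`. Such a `τ` fixes both `t`
  -- and `l` and so commutes with their exchange.
  · have hτl : τ l = l := hτ' l htl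
    have hcomm : π₁ * Equiv.swap t l * τ = π₁ * τ * Equiv.swap t l := by
      rw [mul_assoc, mul_assoc, Equiv.mul_swap_eq_swap_mul, htt, hτl]
    rw [if_pos (c := ∀ r ≤ t, I.rho _ ≤ _), hcomm]
    · refine le_trans (b := φ.firstHire I t (π₁ * τ)) ?_ ?_
      · split_ifs
        · exact le_rfl
        · exact φ.firstHire_nonneg I _ _
      · refine hP.firstHire_le_swap hφ hI htl hl (fun j => ?_) fun r s hr hs hsl => ?_
        · rw [hI.rho_le_iff, Equiv.Perm.mul_apply, hτl]
          exact hmin j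
        · rw [Equiv.Perm.mul_apply, Equiv.Perm.mul_apply]
          have hs' : τ s = s := by
            rcases eq_or_lt_of_le hs with rfl | hs
            · exact htt
            · exact hτ' s hs
          rw [hs']
          refine hmono _ _ (lt_of_lt_of_le (lt_of_le_of_ne (hle r hr.le) fun h => ?_) hs) hsl
          rw [← htt] at h
          exact hr.ne (τ.injective (h.trans (by rw [htt])))
    · intro r _
      rw [hI.rho_le_iff, Equiv.Perm.mul_apply _ τ t, htt, Equiv.Perm.mul_apply,
        Equiv.swap_apply_left]
      exact hmin _
  · rw [if_neg (c := ∀ r ≤ t, I.xi _ ≤ _)]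
    · split_ifs
      · exact φ.firstHire_nonneg I _ _
      · exact le_rfl
    · intro H
      have h3 := H (τ⁻¹ t) (Nat.le_of_lt_succ (apply_val_lt_of_mem_prefixPerms
        (inv_mem_prefixPerms hτ) (Nat.lt_succ_self t)))
      rw [Equiv.Perm.mul_apply, Equiv.Perm.mul_apply] at h3
      have h4 : τ (τ⁻¹ t) = t := τ.apply_symm_apply t
      rw [h4] at h3
      exact absurd h3 (not_le.2 (hmono _ _ (lt_of_le_of_ne (hle t le_rfl) htt) htl))

/-- A candidate can be a record for both players only in round `0`. The resulting disjointness in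
later rounds gives the factor `2` in the budget. -/
theorem Candidates.NegativelyCorrelated.eq_of_best (hI : I.NegativelyCorrelated)
    {π : Equiv.Perm (Fin n)} {t : Fin n} (h1 : ∀ r ≤ t, I.xi (π r) ≤ I.xi (π t))
    (h2 : ∀ r ≤ t, I.rho (π r) ≤ I.rho (π t)) {r : Fin n} (hr : r ≤ t) : r = t :=
  π.injective (I.xi_injective (le_antisymm (h1 r hr) ((hI.rho_le_iff _ _).1 (h2 r hr))))

theorem Candidates.exists_best (v : Fin n → ℝ) (hn : 0 < n) : ∃ c, ∀ j, v j ≤ v c := by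
  have : Nonempty (Fin n) := ⟨⟨0, hn⟩⟩
  obtain ⟨c, -, hc⟩ := exists_max_image univ v univ_nonempty
  exact ⟨c, fun j => hc j (mem_univ _)⟩

open Classical in
/-- The success probability of the sender is at most that of First-Opt with sample size `n / 2`. -/
theorem Mechanism.PersuasiveOn.senderSuccess_le (hφ : φ.IgnoresCardinalValues)
    (hP : φ.PersuasiveOn I) (hI : I.NegativelyCorrelated) (hn : 2 ≤ n) :
    φ.senderSuccess I ≤
      1 / (n : ℝ) * (((n / 2 : ℕ) : ℝ) * (n - (n / 2 : ℕ)) / (n - 1)) := by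
  obtain ⟨c, hc⟩ := Candidates.exists_best I.xi (by omega)
  have hfac : (0 : ℝ) < n.factorial := by positivity
  have hn0 : (0 : ℝ) < n := by positivity
  let y : Fin n → ℝ := fun t =>
    (n : ℝ) / n.factorial * ∑ π, if π t = c then φ.firstHire I t π else 0
  let x : ℕ → ℝ := fun t => if h : t < n then y ⟨t, h⟩ else 0
  let q : ℕ → ℝ := fun t => 1 / (n.factorial : ℝ) * ∑ π, φ.noHire I t π
  have hx : ∀ t : Fin n, x t = y t := fun t => by simp [x]
  have hq : ∀ t : Fin n, q (t + 1) = q t - 1 / (n.factorial : ℝ) * ∑ π, φ.firstHire I t π := by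
    intro t
    simp only [q, φ.noHire_succ, sum_sub_distrib, mul_sub]
  have hbest : ∀ t : Fin n, 1 / (n.factorial : ℝ) *
      ∑ π, (if ∀ r ≤ t, I.xi (π r) ≤ I.xi (π t) then φ.firstHire I t π else 0) =
      1 / ((t : ℝ) + 1) * x t := by
    intro t
    rw [hx]
    have := (hφ.ordinalUpTo_firstHire hI t).sum_best I.xi_injective hc
    simp only [y]
    field_simp
    linarith
  have e : φ.senderSuccess I = 1 / (n : ℝ) * ∑ t ∈ range n, x t := by
    rw [φ.senderSuccess_eq I c hc, ← Fin.sum_univ_eq_sum_range, mul_sum, mul_sum]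
    refine sum_congr rfl fun t _ => ?_
    rw [hx]
    simp only [y]
    field_simp
  rw [e]
  refine mul_le_mul_of_nonneg_left ?_ (by positivity)
  refine sum_le_of_budget (q := q) hn (fun t ht => ?_) (fun t ht => ?_) ?_ ?_ fun t ht1 htn => ?_
  · rw [hx ⟨t, ht⟩]
    exact mul_nonneg (by positivity) (sum_nonneg fun π _ => by
      split_ifs
      · exact φ.firstHire_nonneg I _ _
      · exact le_rfl)
  · rw [hx ⟨t, ht⟩]
    -- The absence of an earlier HIRE is independent of `c` arriving in round `t`, whence `x t ≤ q
    -- t`.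
    have h := (hφ.ordinalUpTo_noHire hI t).sum_apply_eq (t := ⟨t, ht⟩) I.xi_injective c
    simp only [q, y]
    rw [← h, div_eq_inv_mul, mul_assoc, one_div]
    refine mul_le_mul_of_nonneg_left (mul_le_mul_of_nonneg_left (sum_le_sum fun π _ => ?_)
      hn0.le) (by positivity)
    split_ifs
    · exact φ.firstHire_le I _ _
    · exact le_rfl
  · simp [q, φ.noHire_zero, Fintype.card_perm, hfac.ne']
  · have h1 := hq ⟨0, by omega⟩
    have h2 := hbest ⟨0, by omega⟩
    simp only [Nat.cast_zero, zero_add, div_one, one_mul] at h1 h2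
    rw [h1, ← h2]
    refine sub_le_sub_left (mul_le_mul_of_nonneg_left (sum_le_sum fun π _ => ?_)
      (by positivity)) _
    split_ifs
    · exact le_rfl
    · exact φ.firstHire_nonneg I _ _
  · have h1 := hq ⟨t, by omega⟩
    have h2 := hbest ⟨t, by omega⟩
    have h3 := hP.sum_best_le hφ hI (t := ⟨t, by omega⟩) htn
    simp only at h1 h2 h3
    rw [h1]
    refine sub_le_sub_left ?_ _
    have e2 : 2 / ((t : ℝ) + 1) * x t = 1 / ((t : ℝ) + 1) * x t + 1 / ((t : ℝ) + 1) * x t := by ring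
    rw [e2, ← h2, ← mul_add]
    refine mul_le_mul_of_nonneg_left (le_trans (add_le_add_right h3 _) ?_) (by positivity)
    rw [← sum_add_distrib]
    refine sum_le_sum fun π _ => ?_
    have := φ.firstHire_nonneg I ⟨t, by omega⟩ π
    split_ifs with h4 h5
    · have := hI.eq_of_best h4 h5 (r := ⟨0, by omega⟩) (Fin.le_def.2 (Nat.zero_le _))
      simp only [Fin.mk.injEq] at this
      omega
    · simp
    · simp
    · simpa using this

end

/-! ### The success probability of First-Opt -/

/-- The rounds in which First-Opt with sample size `s` signals HIRE unless it has done so before. -/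
def Candidates.Stops {n : ℕ} (I : Candidates n) (s : ℕ) (π : Equiv.Perm (Fin n)) (t : Fin n) :
    Prop :=
  t.val + 1 = n ∨ (s ≤ t.val ∧ BestSoFar (I.arrivals π) t)

section

variable {n : ℕ} {I : Candidates n} {s : ℕ}

open Classical in
theorem firstOpt_hire (t : Fin n) (π : Equiv.Perm (Fin n)) (σ : Fin n → Bool) :
    (firstOpt n s).hire t (I.arrivals π) σ =
      if (∀ r < t, σ r = false) ∧ I.Stops s π t then 1 else 0 := by
  have h : (∃ r < t, σ r = true) ↔ ¬ ∀ r < t, σ r = false := by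
    push Not
    simp
  simp only [firstOpt, h, Candidates.Stops]
  by_cases h1 : ∀ r < t, σ r = false <;> by_cases h2 : t.val + 1 = n <;>
    by_cases h3 : t.val < s <;> simp_all

open Classical in
theorem firstOpt_noHire (k : ℕ) (π : Equiv.Perm (Fin n)) :
    (firstOpt n s).noHire I k π =
      if ∀ r : Fin n, r.val < k → ¬ I.Stops s π r then 1 else 0 := by
  simp only [Mechanism.noHire, firstOpt_hire, implies_true, true_and]
  split_ifs with h
  · refine prod_eq_one fun r hr => ?_
    rw [if_neg (h r (mem_filter.1 hr).2), sub_zero]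
  · push Not at h
    obtain ⟨r, hr, h⟩ := h
    exact prod_eq_zero (mem_filter.2 ⟨mem_univ r, hr⟩) (by rw [if_pos h, sub_self])

open Classical in
theorem firstOpt_firstHire (t : Fin n) (π : Equiv.Perm (Fin n)) :
    (firstOpt n s).firstHire I t π =
      if I.Stops s π t then (firstOpt n s).noHire I t π else 0 := by
  simp only [Mechanism.firstHire, firstOpt_hire, implies_true, true_and, mul_ite, mul_one,
    mul_zero]

theorem firstOpt_ignoresCardinalValues : (firstOpt n s).IgnoresCardinalValues := by
  intro t θ θ' σ h
  have h2 : BestSoFar θ t ↔ BestSoFar θ' t := by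
    unfold BestSoFar
    refine or_congr (forall₂_congr fun r hr => ?_) (forall₂_congr fun r hr => ?_)
    · rw [← not_lt, ← not_lt, (h t le_rfl r hr).1]
    · rw [← not_lt, ← not_lt, (h t le_rfl r hr).2]
  classical
  exact if_congr Iff.rfl rfl (if_congr Iff.rfl rfl (if_congr Iff.rfl rfl (if_congr h2 rfl rfl)))

theorem firstOpt_senderSuccess (hI : I.NegativelyCorrelated) (hn : 2 ≤ n) :
    (firstOpt n (n / 2)).senderSuccess I =
      1 / (n : ℝ) * (((n / 2 : ℕ) : ℝ) * (n - (n / 2 : ℕ)) / (n - 1)) := by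
  classical
  set φ := firstOpt n (n / 2) with hφ
  have hord : φ.IgnoresCardinalValues := firstOpt_ignoresCardinalValues
  obtain ⟨c, hc⟩ := Candidates.exists_best I.xi (by omega)
  obtain ⟨d, hd⟩ := Candidates.exists_best I.rho (by omega)
  have hfac : (0 : ℝ) < n.factorial := by positivity
  have hn0 : (0 : ℝ) < n := by positivity
  let y : Fin n → ℝ := fun t =>
    (n : ℝ) / n.factorial * ∑ π, if π t = c then φ.firstHire I t π else 0
  let x : ℕ → ℝ := fun t => if h : t < n then y ⟨t, h⟩ else 0
  let q : ℕ → ℝ := fun t => 1 / (n.factorial : ℝ) * ∑ π, φ.noHire I t π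
  have hx : ∀ t : Fin n, x t = y t := fun t => by simp [x]
  have e : φ.senderSuccess I = 1 / (n : ℝ) * ∑ t ∈ range n, x t := by
    rw [φ.senderSuccess_eq I c hc, ← Fin.sum_univ_eq_sum_range, mul_sum, mul_sum]
    refine sum_congr rfl fun t _ => ?_
    rw [hx]
    simp only [y]
    field_simp
  have hsum : ∀ (e : Fin n) (t : Fin n), (∀ π : Equiv.Perm (Fin n), π t = e → I.Stops (n / 2) π t) →
      (n : ℝ) * ∑ π, (if π t = e then φ.firstHire I t π else 0) = ∑ π, φ.noHire I t π := by
    intro e t he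
    rw [← (hord.ordinalUpTo_noHire hI t).sum_apply_eq I.xi_injective e]
    congr 1
    refine sum_congr rfl fun π _ => ?_
    split_ifs with h
    · rw [firstOpt_firstHire, if_pos (he π h)]
    · rfl
  have hstopc : ∀ (t : Fin n), n / 2 ≤ t.val → ∀ π : Equiv.Perm (Fin n), π t = c →
      I.Stops (n / 2) π t := fun t ht π h => Or.inr ⟨ht, Or.inl fun r _ => by
    simpa only [Candidates.arrivals, h] using hc (π r)⟩
  have hstopd : ∀ (t : Fin n), n / 2 ≤ t.val → ∀ π : Equiv.Perm (Fin n), π t = d →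
      I.Stops (n / 2) π t := fun t ht π h => Or.inr ⟨ht, Or.inr fun r _ => by
    simpa only [Candidates.arrivals, h] using hd (π r)⟩
  have hnot : ∀ (t : Fin n), t.val < n / 2 → ∀ π : Equiv.Perm (Fin n),
      ¬ I.Stops (n / 2) π t := by
    rintro t ht π (h | h)
    · omega
    · omega
  have hxq : ∀ t < n, n / 2 ≤ t → x t = q t := by
    intro t ht hst
    rw [hx ⟨t, ht⟩]
    simp only [y, q]
    rw [← hsum c ⟨t, ht⟩ (hstopc ⟨t, ht⟩ hst)]
    ring
  rw [e]
  congr 1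
  refine sum_eq_of_budget (q := q) hn (fun t ht => ?_) ?_ hxq fun t hst htn => ?_
  · have htn : t < n := by omega
    rw [hx ⟨t, htn⟩]
    simp only [y]
    rw [sum_eq_zero, mul_zero]
    intro π _
    rw [firstOpt_firstHire, if_neg (hnot ⟨t, htn⟩ ht π), ite_self]
  · have : ∀ π, φ.noHire I (n / 2) π = 1 := fun π => by
      rw [firstOpt_noHire, if_pos fun r hr => hnot r hr π]
    simp [q, this, Fintype.card_perm, hfac.ne']
  · have htn' : t < n := by omega
    rw [hxq t htn' hst]
    set u : Fin n := ⟨t, htn'⟩ with hu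
    -- Before the last round First-Opt stops only at records, and here `t ≥ n / 2 ≥ 1`, so exactly
    -- one of the two kinds occurs. This makes the budget inequality an equality.
    have hsplit : ∀ π, φ.firstHire I u π =
        (if ∀ r ≤ u, I.xi (π r) ≤ I.xi (π u) then φ.firstHire I u π else 0) +
        (if ∀ r ≤ u, I.rho (π r) ≤ I.rho (π u) then φ.firstHire I u π else 0) := by
      intro π
      split_ifs with h4 h5 h5
      · have := hI.eq_of_best h4 h5 (r := ⟨0, by omega⟩) (Fin.le_def.2 (Nat.zero_le _))
        simp only [Fin.mk.injEq, hu] at this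
        omega
      · simp
      · simp
      · rw [firstOpt_firstHire, if_neg, add_zero]
        rintro (h | ⟨-, h | h⟩)
        · simp only [hu] at h
          omega
        · exact h4 h
        · exact h5 h
    have h1 := (hord.ordinalUpTo_firstHire hI u).sum_best I.xi_injective hc
    have h2 := ((hord.ordinalUpTo_firstHire hI u).rho hI).sum_best I.rho_injective hd
    rw [hsum c u (hstopc u hst)] at h1
    rw [hsum d u (hstopd u hst)] at h2
    have h3 : q (t + 1) = q t - 1 / (n.factorial : ℝ) * ∑ π, φ.firstHire I u π := by
      have := fun π => φ.noHire_succ I u π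
      simp only [hu] at this
      simp only [q, this, sum_sub_distrib, mul_sub]
      rfl
    rw [h3, sum_congr rfl fun π _ => hsplit π, sum_add_distrib]
    simp only [q]
    have ht1 : (t : ℝ) + 1 ≠ 0 := by positivity
    simp only [hu] at h1 h2 ⊢
    field_simp
    linear_combination -h1 - h2

theorem half_mul_half_div {n : ℕ} (hn : 2 ≤ n) :
    1 / (n : ℝ) * (((n / 2 : ℕ) : ℝ) * (n - (n / 2 : ℕ)) / (n - 1)) =
      if Even n then (n : ℝ) / (4 * ((n : ℝ) - 1)) else ((n : ℝ) + 1) / (4 * (n : ℝ)) := by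
  have hn2 : (2 : ℝ) ≤ n := by exact_mod_cast hn
  have hn0 : (n : ℝ) ≠ 0 := by linarith
  have hn1 : (n : ℝ) - 1 ≠ 0 := by linarith
  split_ifs with h
  · have h2 : 2 * ((n / 2 : ℕ) : ℝ) = n := by exact_mod_cast Nat.two_mul_div_two_of_even h
    obtain h2 : ((n / 2 : ℕ) : ℝ) = n / 2 := by linarith
    rw [h2]
    field_simp
    ring
  · have h2 : 2 * ((n / 2 : ℕ) : ℝ) + 1 = n := by
      exact_mod_cast Nat.two_mul_div_two_add_one_of_odd (Nat.not_even_iff_odd.1 h)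
    obtain h2 : ((n / 2 : ℕ) : ℝ) = (n - 1) / 2 := by linarith
    rw [h2]
    field_simp
    ring

end

/-! ### Persuasiveness of First-Opt -/

section

variable {n : ℕ} {I : Candidates n} {s : ℕ}

theorem Candidates.stops_congr {π π' : Equiv.Perm (Fin n)} {t : Fin n}
    (h : ∀ r ≤ t, π r = π' r) : I.Stops s π t ↔ I.Stops s π' t := by
  unfold Stops BestSoFar arrivals
  simp only [h t le_rfl]
  refine or_congr Iff.rfl (and_congr Iff.rfl (or_congr ?_ ?_)) <;>
    exact forall₂_congr fun r hr => by rw [h r hr]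

/-- First-Opt sends its HIRE signal in round `H`. -/
def Candidates.IsStop (I : Candidates n) (s : ℕ) (π : Equiv.Perm (Fin n)) (H : Fin n) : Prop :=
  I.Stops s π H ∧ ∀ r < H, ¬ I.Stops s π r

theorem Candidates.exists_isStop (I : Candidates n) (s : ℕ) (hn : 0 < n)
    (π : Equiv.Perm (Fin n)) : ∃ H, I.IsStop s π H := by
  have hne : {t | I.Stops s π t}.Nonempty :=
    ⟨⟨n - 1, by omega⟩, Or.inl (by simp only; omega)⟩
  exact ⟨wellFounded_lt.min _ hne, wellFounded_lt.min_mem _ hne,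
    fun r hr h => wellFounded_lt.not_lt_min {t | I.Stops s π t} h hr⟩

theorem Candidates.IsStop.unique {π : Equiv.Perm (Fin n)} {H H' : Fin n} (h : I.IsStop s π H)
    (h' : I.IsStop s π H') : H = H' := by
  rcases lt_trichotomy H H' with hlt | heq | hlt
  · exact absurd h.1 (h'.2 H hlt)
  · exact heq
  · exact absurd h'.1 (h.2 H' hlt)

theorem Candidates.IsStop.congr {π π' : Equiv.Perm (Fin n)} {H : Fin n} (h : I.IsStop s π H)
    (hπ : ∀ r ≤ H, π r = π' r) : I.IsStop s π' H :=
  ⟨(stops_congr hπ).1 h.1, fun r hr h' =>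
    h.2 r hr ((stops_congr fun u hu => hπ u (hu.trans hr.le)).2 h')⟩

/-- First-Opt is deterministic. -/
theorem firstOpt_prob {π : Equiv.Perm (Fin n)} {H : Fin n} (hH : I.IsStop s π H)
    (σ : Fin n → Bool) : (firstOpt n s).prob I π σ =
      if σ = fun r => decide (r = H) then 1 / (n.factorial : ℝ) else 0 := by
  classical
  simp only [Mechanism.prob, firstOpt_hire]
  split_ifs with hσ
  · subst hσ
    rw [prod_eq_one, mul_one]
    intro t _
    by_cases ht : t = H
    · subst ht
      rw [if_pos (by simp), if_pos ⟨fun r hr => by simpa using hr.ne, hH.1⟩]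
    · rw [if_neg (by simpa using ht), if_neg, sub_zero]
      rintro ⟨h1, h2⟩
      rcases lt_or_gt_of_ne ht with h | h
      · exact hH.2 t h h2
      · simpa using h1 H h
  -- The first signal in which `σ` differs from the true sequence has probability zero.
  · have hne : {t | σ t ≠ decide (t = H)}.Nonempty := by
      by_contra h
      rw [Set.not_nonempty_iff_eq_empty, Set.eq_empty_iff_forall_notMem] at h
      exact hσ (funext fun t => not_not.1 (h t))
    set t := wellFounded_lt.min _ hne with ht
    have h1 : σ t ≠ decide (t = H) := wellFounded_lt.min_mem _ hne
    have h2 : ∀ r < t, σ r = decide (r = H) := fun r hr =>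
      not_not.1 fun h => wellFounded_lt.not_lt_min _ h hr
    rw [prod_eq_zero (mem_univ t), mul_zero]
    rcases lt_trichotomy t H with h | h | h
    · have hσt : σ t = true := by simpa [h.ne] using h1
      rw [if_pos hσt, if_neg fun h' => hH.2 t h h'.2]
    · have hσt : σ t = false := by simpa [h] using h1
      rw [if_neg (by simp [hσt]), if_pos, sub_self]
      refine ⟨fun r hr => ?_, h ▸ hH.1⟩
      rw [h2 r hr]
      simpa using (h ▸ hr).ne
    · have hσt : σ t = true := by simpa [h.ne'] using h1
      rw [if_pos hσt, if_neg]
      rintro ⟨h3, -⟩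
      have := h3 H h
      rw [h2 H h] at this
      simp at this

/-- The first round from `t₀` on in which `τ` hires is `T`. -/
def ReceiverStrategy.HiresFirst (τ : ReceiverStrategy n) (t₀ : Fin n) (π : Equiv.Perm (Fin n))
    (σ : Fin n → Bool) (T : Fin n) : Prop :=
  t₀ ≤ T ∧ τ.hires T π σ ∧ ∀ r < T, t₀ ≤ r → ¬ τ.hires r π σ

theorem ReceiverStrategy.HiresFirst.unique {τ : ReceiverStrategy n} {t₀ : Fin n}
    {π : Equiv.Perm (Fin n)} {σ : Fin n → Bool} {T T' : Fin n} (h : τ.HiresFirst t₀ π σ T)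
    (h' : τ.HiresFirst t₀ π σ T') : T = T' := by
  rcases lt_trichotomy T T' with hlt | heq | hlt
  · exact absurd h.2.1 (h'.2.2 T hlt h.1)
  · exact heq
  · exact absurd h'.2.1 (h.2.2 T' hlt h'.1)

theorem ReceiverStrategy.HiresFirst.congr {τ : ReceiverStrategy n} {t₀ : Fin n}
    {π π' : Equiv.Perm (Fin n)} {σ σ' : Fin n → Bool} {T : Fin n} (h : τ.HiresFirst t₀ π σ T)
    (hπ : ∀ r < T, π r = π' r) (hσ : ∀ r ≤ T, σ r = σ' r) : τ.HiresFirst t₀ π' σ' T :=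
  ⟨h.1, (τ.causal T π π' σ σ' hπ hσ).1 h.2.1, fun r hr hr' h' => h.2.2 r hr hr'
    ((τ.causal r π π' σ σ' (fun u hu => hπ u (hu.trans hr))
      fun u hu => hσ u (hu.trans hr.le)).2 h')⟩

theorem ReceiverStrategy.hiresBestFrom_iff {τ : ReceiverStrategy n} {t₀ : Fin n}
    {π : Equiv.Perm (Fin n)} {σ : Fin n → Bool} {v : Fin n → ℝ} (hv : Function.Injective v)
    {c : Fin n} (hc : ∀ j, v j ≤ v c) :
    τ.HiresBestFrom t₀ v π σ ↔ τ.HiresFirst t₀ π σ (π.symm c) := by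
  constructor
  · rintro ⟨T, h1, h2, h3, h4⟩
    obtain rfl : T = π.symm c := by
      rw [Equiv.eq_symm_apply]
      exact hv (le_antisymm (hc _) (h4 c))
    exact ⟨h1, h2, fun r hr hr' => h3 r hr hr'⟩
  · rintro ⟨h1, h2, h3⟩
    exact ⟨π.symm c, h1, h2, fun r hr hr' => h3 r hr hr', by
      rw [Equiv.apply_symm_apply]
      exact hc⟩

theorem mul_swap_apply_of_lt {a l r : Fin n} (π : Equiv.Perm (Fin n)) (hr : r < a)
    (hl : ∀ r, r ≤ l) : (π * Equiv.swap a l) r = π r := by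
  rw [Equiv.Perm.mul_apply, Equiv.swap_apply_of_ne_of_ne hr.ne (hr.trans_le (hl a)).ne]

/-- A candidate arriving in round `T` before or after the HIRE signal of First-Opt can be exchanged
with the last one without changing the signals up to round `T` if the candidate is the best one for
the receiver. -/
theorem Candidates.IsStop.swap_last (hs : s < n) {c : Fin n} (hc : ∀ j, I.rho j ≤ I.rho c)
    {π : Equiv.Perm (Fin n)} {H H' T l : Fin n} (hl : ∀ r, r ≤ l) (hT : π T = c)
    (hH : I.IsStop s π H) (hH' : I.IsStop s (π * Equiv.swap T l) H') (hne : H ≠ T) :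
    H' ≠ T ∧ ∀ r ≤ T, decide (r = H) = decide (r = H') := by
  rcases lt_or_gt_of_ne hne with hlt | hlt
  · have : H' = H := hH'.unique (hH.congr fun r hr =>
      (mul_swap_apply_of_lt π (hr.trans_lt hlt) hl).symm)
    exact ⟨this ▸ hne, fun r _ => by rw [this]⟩
  -- Outside the sample c_R would trigger HIRE, so a round `T` before `H` lies in the sample, and no
  -- exchange can move the HIRE signal there.
  · have hTs : T.val < s := by
      by_contra h
      refine hH.2 T hlt (Or.inr ⟨not_lt.1 h, Or.inr fun r _ => ?_⟩)
      simpa only [arrivals, hT] using hc (π r)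
    have hTH' : T < H' := by
      rcases hH'.1 with h | h
      · exact Fin.lt_def.2 (hTs.trans_le (Nat.le_of_lt_succ (hs.trans_eq h.symm)))
      · exact Fin.lt_def.2 (by omega)
    exact ⟨hTH'.ne', fun r hr => by
      simp [(hr.trans_lt hlt).ne, (hr.trans_lt hTH').ne]⟩

/-- Exchanging the last candidate, if it is the best one for the receiver, with the candidate whom
First-Opt hires does not change the signals. -/
theorem Candidates.IsStop.swap_at_stopping_round {c : Fin n} (hc : ∀ j, I.rho j ≤ I.rho c)
    {π : Equiv.Perm (Fin n)} {H l : Fin n} (hl : ∀ r, r ≤ l) (hπ : π l = c)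
    (hH : I.IsStop s π H) : I.IsStop s (π * Equiv.swap H l) H := by
  refine ⟨hH.1.imp id fun h => ⟨h.1, Or.inr fun r _ => ?_⟩, fun r hr h => hH.2 r hr ?_⟩
  · simpa only [arrivals, Equiv.Perm.mul_apply π _ H, Equiv.swap_apply_left, hπ] using hc _
  · exact (stops_congr fun u hu => mul_swap_apply_of_lt π (hu.trans_lt hr) hl).1 h

-- The arrival order determines the signals, so success probabilities become numbers of orders.
open Classical in
theorem firstOpt_receiverSuccessAt {H : Equiv.Perm (Fin n) → Fin n}
    (hH : ∀ π, I.IsStop s π (H π)) {c : Fin n} (hc : ∀ j, I.rho j ≤ I.rho c) (t₀ : Fin n)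
    (π₀ : Equiv.Perm (Fin n)) (σ₀ : Fin n → Bool) (τ : ReceiverStrategy n) :
    (firstOpt n s).receiverSuccessAt I t₀ π₀ σ₀ τ =
      #{π : Equiv.Perm (Fin n) | (∀ r < t₀, π r = π₀ r) ∧ (∀ r ≤ t₀, decide (r = H π) = σ₀ r) ∧
        τ.HiresFirst t₀ π (fun r => decide (r = H π)) (π.symm c)} * (1 / (n.factorial : ℝ)) := by
  rw [← nsmul_eq_mul, ← sum_const, sum_filter]
  refine sum_congr rfl fun π _ => ?_
  rw [sum_eq_single fun r => decide (r = H π)]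
  · rw [firstOpt_prob (hH π), if_pos rfl]
    exact if_congr (and_congr Iff.rfl (and_congr Iff.rfl
      (ReceiverStrategy.hiresBestFrom_iff I.rho_injective hc))) rfl rfl
  · intro σ _ hσ
    rw [firstOpt_prob (hH π), if_neg hσ, ite_self]
  · simp

theorem firstOpt_persuasiveOn (hs : s < n) (I : Candidates n) :
    (firstOpt n s).PersuasiveOn I := by
  classical
  have hn : 0 < n := by omega
  intro t₀ π₀ σ₀ hσ₀ τ
  choose H hH using I.exists_isStop s hn
  obtain ⟨c, hc⟩ := Candidates.exists_best I.rho hn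
  obtain ⟨l, hl⟩ : ∃ l : Fin n, ∀ r, r ≤ l :=
    ⟨⟨n - 1, by omega⟩, fun r => Fin.le_def.2 (by simp only; omega)⟩
  rw [firstOpt_receiverSuccessAt hH hc, firstOpt_receiverSuccessAt hH hc]
  refine mul_le_mul_of_nonneg_right (Nat.cast_le.2 ?_) (by positivity)
  let sig : Equiv.Perm (Fin n) → Fin n → Bool := fun π r => decide (r = H π)
  -- `g` moves c_R to the last round, and `f` moves it from there to the round of the HIRE signal.
  let g : Equiv.Perm (Fin n) → Equiv.Perm (Fin n) := fun π => π * Equiv.swap (π.symm c) l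
  let f : Equiv.Perm (Fin n) → Equiv.Perm (Fin n) := fun π => g π * Equiv.swap (H (g π)) l
  have hle : ∀ π : Equiv.Perm (Fin n), (∀ r ≤ t₀, sig π r = σ₀ r) → t₀ ≤ H π := by
    intro π h
    by_contra hlt
    rw [not_le] at hlt
    have := h (H π) hlt.le
    rw [hσ₀ _ hlt] at this
    simp [sig] at this
  have hobed : ∀ π : Equiv.Perm (Fin n), t₀ ≤ H π →
      π (H π) = c → (obedient n).HiresFirst t₀ π (sig π) (π.symm c) := by
    intro π h h'
    have e : π.symm c = H π := by rw [← h', Equiv.symm_apply_apply]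
    rw [e]
    exact ⟨h, by simp [obedient, sig], fun r hr _ => by simpa [obedient, sig] using hr.ne⟩
  have main : ∀ π : Equiv.Perm (Fin n), (∀ r < t₀, π r = π₀ r) → (∀ r ≤ t₀, sig π r = σ₀ r) →
      τ.HiresFirst t₀ π (sig π) (π.symm c) → H π ≠ π.symm c →
      (∀ r < t₀, f π r = π₀ r) ∧ (∀ r ≤ t₀, sig (f π) r = σ₀ r) ∧ f π (H (f π)) = c ∧
      ¬ τ.HiresFirst t₀ (f π) (sig (f π)) (H (f π)) ∧
      g π = f π * Equiv.swap (H (f π)) l ∧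
      τ.HiresFirst t₀ (g π) (sig (g π)) (π.symm c) := by
    intro π h1 h2 h3 h4
    set T := π.symm c with hT
    have hTc : π T = c := π.apply_symm_apply c
    obtain ⟨h5, h6⟩ := (hH π).swap_last hs hc hl hTc (hH (g π)) h4
    have hgl : g π l = c := by
      simp only [g]
      rw [Equiv.Perm.mul_apply, Equiv.swap_apply_right, Equiv.apply_symm_apply]
    have hHf : H (f π) = H (g π) := (hH (f π)).unique ((hH (g π)).swap_at_stopping_round hc hl hgl)
    have hsig : sig (f π) = sig (g π) := by
      simp only [sig, hHf]
    have hsigg : ∀ r ≤ t₀, sig (g π) r = σ₀ r := fun r hr => by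
      rw [← h2 r hr]
      exact (h6 r (hr.trans h3.1)).symm
    have ht₀ : t₀ ≤ H (g π) := hle _ hsigg
    have hg : τ.HiresFirst t₀ (g π) (sig (g π)) T :=
      h3.congr (fun r hr => (mul_swap_apply_of_lt π hr hl).symm) h6
    have hfg : ∀ r < H (g π), f π r = g π r := fun r hr => mul_swap_apply_of_lt (g π) hr hl
    refine ⟨fun r hr => ?_, fun r hr => ?_, ?_, fun h => ?_, ?_, hg⟩
    · rw [hfg r (hr.trans_le ht₀), ← h1 r hr]
      exact mul_swap_apply_of_lt π (hr.trans_le h3.1) hl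
    · rw [hsig, hsigg r hr]
    · rw [hHf]
      simp only [f]
      rw [Equiv.Perm.mul_apply, Equiv.swap_apply_left, hgl]
    · rw [hsig, hHf] at h
      exact h5 ((h.congr hfg fun _ _ => rfl).unique hg)
    · rw [hHf]
      simp only [f]
      rw [mul_assoc, Equiv.swap_mul_self, mul_one]
  -- Orders in which `τ` already hires at the HIRE signal stay fixed. They differ from all values `f
  -- π`, on which `τ` does not hire at that signal. From `f π` one recovers `g π`, then the old
  -- round of c_R as the round in which `τ` hires on `g π`, and thereby `π`.
  refine card_le_card_of_injOn (fun π => if H π = π.symm c then π else f π) ?_ ?_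
  · intro π hπ
    simp only [coe_filter, mem_univ, true_and, Set.mem_ofPred_eq] at hπ ⊢
    obtain ⟨h1, h2, h3⟩ := hπ
    split_ifs with h
    · exact ⟨h1, h2, hobed π (hle π h2) (by rw [h, Equiv.apply_symm_apply])⟩
    · obtain ⟨h4, h5, h6, -⟩ := main π h1 h2 h3 h
      exact ⟨h4, h5, hobed (f π) (hle _ h5) h6⟩
  · intro π hπ π' hπ' heq
    simp only [coe_filter, mem_univ, true_and, Set.mem_ofPred_eq] at hπ hπ' heq
    obtain ⟨h1, h2, h3⟩ := hπ
    obtain ⟨h1', h2', h3'⟩ := hπ'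
    split_ifs at heq with h h' h'
    · exact heq
    · refine absurd ?_ (main π' h1' h2' h3' h').2.2.2.1
      rw [← heq, h]
      exact h3
    · refine absurd ?_ (main π h1 h2 h3 h).2.2.2.1
      rw [heq, h']
      exact h3'
    · obtain ⟨-, -, -, -, h4, h5⟩ := main π h1 h2 h3 h
      obtain ⟨-, -, -, -, h4', h5'⟩ := main π' h1' h2' h3' h'
      have hg : g π = g π' := by rw [h4, h4', heq]
      rw [hg] at h5
      have hT := h5.unique h5'
      simp only [g, hT] at hg
      exact mul_right_cancel hg

/-- With a single candidate, First-Opt hires it. -/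
theorem Mechanism.senderSuccess_le_firstOpt_one (φ : Mechanism 1) (I : Candidates 1) :
    φ.senderSuccess I ≤ (firstOpt 1 0).senderSuccess I := by
  have hc : ∀ j, I.xi j ≤ I.xi 0 := fun j => by rw [Subsingleton.elim j 0]
  rw [φ.senderSuccess_eq I 0 hc, (firstOpt 1 0).senderSuccess_eq I 0 hc]
  refine mul_le_mul_of_nonneg_left (sum_le_sum fun t _ => sum_le_sum fun π _ => ?_)
    (by positivity)
  have ht : t.val = 0 := by omega
  split_ifs
  · refine (φ.firstHire_le I t π).trans ?_
    rw [firstOpt_firstHire, if_pos (show I.Stops 0 π t from Or.inl (by omega)), ht, φ.noHire_zero,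
      Mechanism.noHire_zero]
  · exact le_rfl

end

end SecretaryPersuasion

theorem mainTheorem4 (n : ℕ) (hn : 1 ≤ n) :
    -- First-Opt uses rankings only and is persuasive whatever the valuation pairs are
    (SecretaryPersuasion.firstOpt n (n / 2)).IgnoresCardinalValues ∧
    (∀ I : SecretaryPersuasion.Candidates n,
      (SecretaryPersuasion.firstOpt n (n / 2)).PersuasiveOn I) ∧
    -- for negatively correlated utilities it is optimal, and the optimum is about 1/4
    ∀ I : SecretaryPersuasion.Candidates n, I.NegativelyCorrelated →
      (∀ φ : SecretaryPersuasion.Mechanism n, φ.IgnoresCardinalValues → φ.PersuasiveOn I →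
        φ.senderSuccess I ≤ (SecretaryPersuasion.firstOpt n (n / 2)).senderSuccess I) ∧
      (2 ≤ n → (SecretaryPersuasion.firstOpt n (n / 2)).senderSuccess I =
        if Even n then (n : ℝ) / (4 * ((n : ℝ) - 1)) else ((n : ℝ) + 1) / (4 * (n : ℝ))) := by
  refine ⟨SecretaryPersuasion.firstOpt_ignoresCardinalValues,
    SecretaryPersuasion.firstOpt_persuasiveOn (by omega), fun I hI => ⟨fun φ hφ hP => ?_,
    fun h2 => ?_⟩⟩
  -- A single candidate is treated separately, since the value of the linear program has the
  -- denominator `n - 1`.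
  · rcases eq_or_lt_of_le hn with rfl | h2
    · exact φ.senderSuccess_le_firstOpt_one I
    · rw [SecretaryPersuasion.firstOpt_senderSuccess hI h2]
      exact hP.senderSuccess_le hφ hI h2
  · rw [SecretaryPersuasion.firstOpt_senderSuccess hI h2,
      SecretaryPersuasion.half_mul_half_div h2]
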